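/- A \emph{metric graph} is a connected compact metric space $(G,d_G)$ that is isometric to the geometric realization of a finite one-dimensional simplicial complex (with at least one edge) whose edges are assigned positive lengths, the realization being endowed with the geodesic distance, i.e. the infimum of the lengths of the paths between two points. It carries its uniform probability measure $\mu_G$, the normalized length measure, and its \emph{local distance distribution} is $h_G(x,r)=\mu_G(\{z\in G : d_G(x,z)\le r\})$ for $x\in G$, $r\ge 0$. A map $\phi:G\to H$ between metric graphs is \emph{measure-preserving} if $\phi_\#\mu_G=\mu_H$. An \emph{isomorphism of mm-spaces} (metric measure spaces) is a measure-preserving map that is also a surjective isometry. A \emph{circle graph} is a metric graph that, with its uniform measure, is isomorphic as an mm-space to a circle of some circumference $T>0$ with arclength distance and normalized uniform measure. \textbf{Theorem.} Let $G$ and $H$ be metric graphs, with $G$ not a circle graph, and let $\phi:G\to H$ be a continuous measure-preserving map such that $$h_G(x,r)=h_H(\phi(x),r)\qquad\text{for all } x\in G \text{ and all } r\ge 0.$$ Then $\phi$ is an isomorphism of mm-spaces. -/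

import Mathlib

open MeasureTheory Measure

noncomputable section

/-- A finite one-dimensional simplicial complex with edge lengths. A simplicial complex of
dimension at most one is the same thing as a simple graph: the simplices are the vertices and the
edges. Dimension one means that there is at least one edge. -/
structure WeightedComplex (V : Type) where
  graph : SimpleGraph V
  length : Sym2 V → ℝ
  length_pos : ∀ e ∈ graph.edgeSet, 0 < length e
  exists_edge : graph.edgeSet.Nonempty

namespace WeightedComplex

variable {V : Type} [Fintype V]

/-- The geometric realization `|K|`, in barycentric coordinates: convex combinations
of vertices whose support is contained in a simplex, that is, in a vertex or in an edge. -/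
def Realization (K : WeightedComplex V) : Type :=
  {w : V → ℝ // (∀ v, 0 ≤ w v) ∧ ∑ v, w v = 1 ∧
    ((∃ u, ∀ x, w x ≠ 0 → x = u) ∨
      (∃ u v, K.graph.Adj u v ∧ ∀ x, w x ≠ 0 → x = u ∨ x = v))}

/-- `p` lies on the closed edge with the endpoints `u` and `v`. -/
def OnEdge {K : WeightedComplex V} (p : K.Realization) (u v : V) : Prop :=
  ∀ x, p.1 x ≠ 0 → x = u ∨ x = v

/-- `K.PathLength p q L`: there is a piecewise linear path in `|K|` from `p` to `q` of total
length `L`. Each of its segments runs inside one closed edge `{u, v}`, and the segment from `p` to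
`q` in this edge has the length `ℓ(u, v) * |p u - q u|`. -/
inductive PathLength (K : WeightedComplex V) : K.Realization → K.Realization → ℝ → Prop
  | refl (p : K.Realization) : PathLength K p p 0
  | step (u v : V) (p q r : K.Realization) (L : ℝ) (hadj : K.graph.Adj u v)
      (hp : OnEdge p u v) (hq : OnEdge q u v) (hqr : PathLength K q r L) :
      PathLength K p r (K.length s(u, v) * |p.1 u - q.1 u| + L)

end WeightedComplex

/-- A metric graph: a connected compact metric space that is isometric to the geometric realization
of a finite one-dimensional simplicial complex with positive edge lengths, where the realization
carries the geodesic distance, the infimum of the lengths of paths between two points. -/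
def IsMetricGraph (X : Type*) [MetricSpace X] : Prop :=
  CompactSpace X ∧ ConnectedSpace X ∧
    ∃ (V : Type) (_ : Fintype V) (K : WeightedComplex V) (f : X ≃ K.Realization),
      ∀ x y : X, IsGLB {L : ℝ | K.PathLength (f x) (f y) L} (dist x y)

/-- The uniform probability measure of a metric graph: its length measure (the one-dimensional
Hausdorff measure) normalized to have the total mass one. -/
def uniformMeasure (X : Type*) [MetricSpace X] [MeasurableSpace X] [BorelSpace X] : Measure X :=
  (μH[1] (Set.univ : Set X))⁻¹ • μH[1]

/-- The local distance distribution `h(x, r) = μ(B̄(x, r))` of a metric measure space. -/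
def localDistribution {X : Type*} [MetricSpace X] [MeasurableSpace X] (μ : Measure X)
    (x : X) (r : ℝ) : ℝ :=
  μ.real (Metric.closedBall x r)

/-- An isomorphism of metric measure spaces: a measure-preserving (surjective) isometry. -/
structure IsMMIsomorphism {X Y : Type*} [MetricSpace X] [MeasurableSpace X] [MetricSpace Y]
    [MeasurableSpace Y] (μ : Measure X) (ν : Measure Y) (φ : X → Y) : Prop where
  measurePreserving : MeasurePreserving φ μ ν
  isometry : Isometry φ
  surjective : Function.Surjective φ

/-- `X`, with its uniform measure, is isomorphic to a circle of some circumference `T > 0` with the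
arclength distance (this is the metric of `AddCircle T = ℝ / Tℤ`) and the uniform measure. -/
def IsCircleGraph (X : Type*) [MetricSpace X] [MeasurableSpace X] [BorelSpace X] : Prop :=
  ∃ T : ℝ, 0 < T ∧ ∃ f : X → AddCircle T,
    IsMMIsomorphism (uniformMeasure X) (uniformMeasure (AddCircle T)) f

end

/-! The proof recovers from `h_G` the distance of a point to the nearest vertex. Present a graph by
arclength edges and absorb every vertex of valence two into a longer edge. If this process meets a
loop at whose base point no other edge ends, the whole space is a circle; otherwise it ends in a
reduced presentation (`isCircleGraph_or_exists_reduced`). In a reduced graph let `x` lie at distance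
`t` from one end of its edge, with `t` positive and less than half the edge length, and let `k` be
the valence of that end. For `r` up to a bound slightly above `t`, the closed ball of radius `r` at
`x` has length `2r + (k - 2) max(r - t, 0)` (`exists_measure_closedBall`). As `k ≠ 2`, the kink at
`r = t` is visible, so the ball measures determine `t`.

The graph `H` is not a circle either, since its balls would have measures independent of the center,
and so would those of `G`. So both graphs have reduced presentations. They have the same total
length, because for small `r` the two distributions at a generic point are `2r` divided by the total
length. Hence `φ` preserves the distance to the nearest vertex, and it is isometric on each set of
points of one open half edge that are sent into one open half edge (`dist_map_eq`). Up to finite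
sets these finitely many pieces cover everything, so `φ` does not increase length.

Since a connected set is at least as long as the distance between any two of its points, the
continuous map `φ` is `1`-Lipschitz along edges, and therefore globally (`dist_map_le`). Then the
preimage of each ball about `φ x` contains the ball about `x` of the same radius. The two have equal
measure, and nonempty open sets have positive measure, so no distance can shrink
(`isometry_of_dist_map_le`). Surjectivity holds because the complement of the compact image is open
and null. -/

/-- A presentation of a metric space as a finite graph whose edges `i` are parametrized by arclength
on `[0, len i]`: the edges have disjoint interiors, and the metric is the largest one for which
all edges are `1`-Lipschitz. -/
structure EdgeParam (X : Type*) [MetricSpace X] (ι : Type) where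
  len : ι → ℝ
  path : ι → ℝ → X
  len_pos : ∀ i, 0 < len i
  cover : ∀ x, ∃ i, ∃ s ∈ Set.Icc 0 (len i), path i s = x
  inj : ∀ i j, ∀ s ∈ Set.Ioo 0 (len i), ∀ s' ∈ Set.Icc 0 (len j),
    path i s = path j s' → i = j ∧ s = s'
  dist_le : ∀ i, ∀ s ∈ Set.Icc 0 (len i), ∀ s' ∈ Set.Icc 0 (len i),
    dist (path i s) (path i s') ≤ |s - s'|
  sub_le_dist : ∀ F : X → ℝ,
    (∀ i, ∀ s ∈ Set.Icc 0 (len i), ∀ s' ∈ Set.Icc 0 (len i),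
      F (path i s) - F (path i s') ≤ |s - s'|) →
    ∀ x y, F x - F y ≤ dist x y

/-! ### Gluing, reversing, halving and merging edges -/

namespace EdgeParam

variable {X : Type*} [MetricSpace X] {ι : Type}

/-- Functions on the edges that agree at the vertices glue. -/
theorem exists_glue (N : EdgeParam X ι) (g : ι → ℝ → ℝ) (v : X → ℝ)
    (h0 : ∀ i, g i 0 = v (N.path i 0)) (h1 : ∀ i, g i (N.len i) = v (N.path i (N.len i))) :
    ∃ F : X → ℝ, ∀ i, ∀ s ∈ Set.Icc 0 (N.len i), F (N.path i s) = g i s := by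
  choose a b hb hab using N.cover
  refine ⟨fun x => g (a x) (b x), fun i s hs => ?_⟩
  have key := hab (N.path i s)
  have hbx := hb (N.path i s)
  set j := a (N.path i s)
  set s' := b (N.path i s)
  change g j s' = g i s
  -- The chosen parameter of a point can differ from the given one only if both are ends of edges,
  -- and there both values are given by `v`.
  by_cases hsi : s ∈ Set.Ioo 0 (N.len i)
  · obtain ⟨h, h'⟩ := N.inj i j s hsi s' hbx key.symm
    rw [← h, ← h']
  by_cases hsj : s' ∈ Set.Ioo 0 (N.len j)
  · obtain ⟨h, h'⟩ := N.inj j i s' hsj s hs key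
    rw [h, h']
  have e1 : g j s' = v (N.path j s') := by
    rcases eq_or_lt_of_le hbx.1 with h | h
    · rw [← h, h0]
    · rcases eq_or_lt_of_le hbx.2 with h' | h'
      · rw [h', h1]
      · exact absurd ⟨h, h'⟩ hsj
  have e2 : g i s = v (N.path i s) := by
    rcases eq_or_lt_of_le hs.1 with h | h
    · rw [← h, h0]
    · rcases eq_or_lt_of_le hs.2 with h' | h'
      · rw [h', h1]
      · exact absurd ⟨h, h'⟩ hsi
  rw [e1, e2, key]

/-- By maximality of the metric, being `1`-Lipschitz on each edge suffices. Such glued functions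
provide lower bounds for distances. -/
theorem exists_lipschitz_glue (N : EdgeParam X ι) (g : ι → ℝ → ℝ) (v : X → ℝ)
    (h0 : ∀ i, g i 0 = v (N.path i 0)) (h1 : ∀ i, g i (N.len i) = v (N.path i (N.len i)))
    (hg : ∀ i s s', g i s - g i s' ≤ |s - s'|) :
    ∃ F : X → ℝ, (∀ i, ∀ s ∈ Set.Icc 0 (N.len i), F (N.path i s) = g i s) ∧
      ∀ x y, F x - F y ≤ dist x y := by
  obtain ⟨F, hF⟩ := N.exists_glue g v h0 h1
  refine ⟨F, hF, N.sub_le_dist F fun i s hs s' hs' => ?_⟩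
  rw [hF i s hs, hF i s' hs']
  exact hg i s s'

/-- Reverse the edges `i` with `c i = true`. -/
noncomputable def flip (N : EdgeParam X ι) (c : ι → Bool) : EdgeParam X ι where
  len := N.len
  path i s := if c i then N.path i (N.len i - s) else N.path i s
  len_pos := N.len_pos
  cover x := by
    obtain ⟨i, s, hs, h⟩ := N.cover x
    by_cases hc : c i
    · exact ⟨i, N.len i - s, ⟨by linarith [hs.2], by linarith [hs.1]⟩, by simp [hc, h]⟩
    · exact ⟨i, s, hs, by simp [hc, h]⟩
  inj i j s hs s' hs' h := by
    have hs2 : N.len i - s ∈ Set.Ioo 0 (N.len i) := ⟨by linarith [hs.2], by linarith [hs.1]⟩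
    have hs2' : N.len j - s' ∈ Set.Icc 0 (N.len j) := ⟨by linarith [hs'.2], by linarith [hs'.1]⟩
    by_cases hc : c i <;> by_cases hc' : c j <;>
      simp only [hc, hc', if_true, Bool.false_eq_true, if_false] at h
    · obtain ⟨rfl, h2⟩ := N.inj _ _ _ hs2 _ hs2' h
      exact ⟨rfl, by linarith⟩
    · obtain ⟨rfl, h2⟩ := N.inj _ _ _ hs2 _ hs' h
      exact absurd hc hc'
    · obtain ⟨rfl, h2⟩ := N.inj _ _ _ hs _ hs2' h
      exact absurd hc' hc
    · exact N.inj _ _ _ hs _ hs' h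
  dist_le i s hs s' hs' := by
    by_cases hc : c i
    · simp only [hc, if_true]
      refine (N.dist_le i _ ⟨by linarith [hs.2], by linarith [hs.1]⟩ _
        ⟨by linarith [hs'.2], by linarith [hs'.1]⟩).trans (le_of_eq ?_)
      rw [abs_sub_comm]; congr 1; ring
    · simpa only [hc, Bool.false_eq_true, if_false] using N.dist_le i s hs s' hs'
  sub_le_dist F hF := by
    refine N.sub_le_dist F fun i s hs s' hs' => ?_
    by_cases hc : c i
    · have := hF i (N.len i - s) ⟨by linarith [hs.2], by linarith [hs.1]⟩ (N.len i - s')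
        ⟨by linarith [hs'.2], by linarith [hs'.1]⟩
      simp only [hc, if_true, sub_sub_cancel] at this
      refine this.trans (le_of_eq ?_)
      rw [abs_sub_comm]; congr 1; ring
    · simpa only [hc, Bool.false_eq_true, if_false] using hF i s hs s' hs'

/-- Subdivide every edge at its midpoint; both halves start at the old vertices. -/
noncomputable def halves (N : EdgeParam X ι) : EdgeParam X (ι × Bool) where
  len a := N.len a.1 / 2
  path a s := if a.2 then N.path a.1 (N.len a.1 - s) else N.path a.1 s
  len_pos a := half_pos (N.len_pos a.1)
  cover x := by
    obtain ⟨i, s, hs, h⟩ := N.cover x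
    by_cases hc : s ≤ N.len i / 2
    · exact ⟨(i, false), s, ⟨hs.1, hc⟩, by simpa using h⟩
    · exact ⟨(i, true), N.len i - s, ⟨by linarith [hs.2], by push Not at hc; dsimp; linarith⟩,
        by simpa using h⟩
  inj := by
    rintro ⟨i, b⟩ ⟨j, b'⟩ s hs s' hs' h
    dsimp only at hs hs' h
    have hi := N.len_pos i
    have hj := N.len_pos j
    obtain ⟨h1, h2⟩ := hs
    obtain ⟨h3, h4⟩ := hs'
    have hs2 : N.len i - s ∈ Set.Ioo 0 (N.len i) := ⟨by linarith, by linarith⟩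
    have hs3 : s ∈ Set.Ioo 0 (N.len i) := ⟨by linarith, by linarith⟩
    have hs2' : N.len j - s' ∈ Set.Icc 0 (N.len j) := ⟨by linarith, by linarith⟩
    have hs3' : s' ∈ Set.Icc 0 (N.len j) := ⟨by linarith, by linarith⟩
    cases b <;> cases b' <;> simp only [if_true, Bool.false_eq_true, if_false] at h
    · obtain ⟨rfl, h2⟩ := N.inj _ _ _ hs3 _ hs3' h
      exact ⟨rfl, h2⟩
    · obtain ⟨rfl, h2⟩ := N.inj _ _ _ hs3 _ hs2' h
      linarith
    · obtain ⟨rfl, h2⟩ := N.inj _ _ _ hs2 _ hs3' h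
      linarith
    · obtain ⟨rfl, h2⟩ := N.inj _ _ _ hs2 _ hs2' h
      exact ⟨rfl, by linarith⟩
  dist_le := by
    rintro ⟨i, b⟩ s ⟨h1, h2⟩ s' ⟨h3, h4⟩
    have hi := N.len_pos i
    dsimp only at h2 h4
    cases b <;> simp only [if_true, Bool.false_eq_true, if_false]
    · exact N.dist_le i s ⟨h1, by linarith⟩ s' ⟨h3, by linarith⟩
    · refine (N.dist_le i _ ⟨by linarith, by linarith⟩ _ ⟨by linarith, by linarith⟩).trans
        (le_of_eq ?_)
      rw [abs_sub_comm]; congr 1; ring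
  sub_le_dist F hF := by
    refine N.sub_le_dist F fun i s hs s' hs' => ?_
    obtain ⟨h1, h2⟩ := hs
    obtain ⟨h3, h4⟩ := hs'
    have hi := N.len_pos i
    have A : ∀ s s', 0 ≤ s → s ≤ N.len i / 2 → 0 ≤ s' → s' ≤ N.len i / 2 →
        F (N.path i s) - F (N.path i s') ≤ |s - s'| := fun s s' h1 h2 h3 h4 => by
      simpa using hF (i, false) s ⟨h1, h2⟩ s' ⟨h3, h4⟩
    have B : ∀ s s', N.len i / 2 ≤ s → s ≤ N.len i → N.len i / 2 ≤ s' → s' ≤ N.len i →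
        F (N.path i s) - F (N.path i s') ≤ |s - s'| := fun s s' h1 h2 h3 h4 => by
      have := hF (i, true) (N.len i - s) ⟨by linarith, by dsimp; linarith⟩ (N.len i - s')
        ⟨by linarith, by dsimp; linarith⟩
      simp only [if_true, sub_sub_cancel] at this
      refine this.trans (le_of_eq ?_)
      rw [abs_sub_comm]; congr 1; ring
    rcases le_total s (N.len i / 2) with h5 | h5 <;> rcases le_total s' (N.len i / 2) with h6 | h6
    · exact A s s' h1 h5 h3 h6
    · have a := A s (N.len i / 2) h1 h5 (by linarith) le_rfl
      have b := B (N.len i / 2) s' le_rfl (by linarith) h6 h4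
      rw [abs_of_nonpos (by linarith)] at a b ⊢
      linarith
    · have a := B s (N.len i / 2) h5 h2 le_rfl (by linarith)
      have b := A (N.len i / 2) s' (by linarith) le_rfl h3 h6
      rw [abs_of_nonneg (by linarith)] at a b ⊢
      linarith
    · exact B s s' h5 h2 h6 h4

/-- The distance to the complement of an edge detects the arclength on both halves. -/
theorem exists_tent (N : EdgeParam X ι) (i : ι) :
    ∃ F : X → ℝ, (∀ s ∈ Set.Icc 0 (N.len i), F (N.path i s) = min s (N.len i - s)) ∧
      (∀ j, j ≠ i → ∀ s ∈ Set.Icc 0 (N.len j), F (N.path j s) = 0) ∧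
      ∀ x y, F x - F y ≤ dist x y := by
  classical
  obtain ⟨F, h1, h2⟩ := N.exists_lipschitz_glue
    (fun j s => if j = i then min s (N.len i - s) else 0) (fun _ => 0)
    (fun j => by
      by_cases h : j = i
      · subst h; simp [(N.len_pos j).le]
      · simp [h])
    (fun j => by
      by_cases h : j = i
      · subst h; simp [(N.len_pos j).le]
      · simp [h])
    (fun j s s' => by
      by_cases h : j = i
      · simp only [h, if_true]
        have := le_abs_self (s - s')
        have := neg_abs_le (s - s')
        rcases min_cases s (N.len i - s) with ⟨h1, h2⟩ | ⟨h1, h2⟩ <;>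
        rcases min_cases s' (N.len i - s') with ⟨h3, h4⟩ | ⟨h3, h4⟩ <;> rw [h1, h3] <;> linarith
      · simp [h])
  refine ⟨F, fun s hs => by simp [h1 i s hs], fun j hj s hs => by simp [h1 j s hs, hj], h2⟩

/-- A whole edge need not be isometric to an interval, since its ends may be joined by a shortcut.
On a half edge the tent function of the edge equals the parameter, which rules shortcuts out. -/
theorem dist_path_halves (N : EdgeParam X ι) (a : ι × Bool) (s : ℝ)
    (hs : s ∈ Set.Icc 0 (N.halves.len a)) (s' : ℝ) (hs' : s' ∈ Set.Icc 0 (N.halves.len a)) :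
    dist (N.halves.path a s) (N.halves.path a s') = |s - s'| := by
  refine le_antisymm (N.halves.dist_le a s hs s' hs') ?_
  obtain ⟨F, h1, -, h3⟩ := N.exists_tent a.1
  have hi := N.len_pos a.1
  have key : ∀ s ∈ Set.Icc 0 (N.halves.len a), F (N.halves.path a s) = s := by
    rintro s ⟨h4, h5⟩
    change s ≤ N.len a.1 / 2 at h5
    change F (if a.2 then N.path a.1 (N.len a.1 - s) else N.path a.1 s) = s
    split_ifs
    · rw [h1 _ ⟨by linarith, by linarith⟩, min_eq_right (by linarith)]; ring
    · rw [h1 _ ⟨by linarith, by linarith⟩, min_eq_left (by linarith)]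
  have a1 := h3 (N.halves.path a s) (N.halves.path a s')
  have a2 := h3 (N.halves.path a s') (N.halves.path a s)
  rw [key s hs, key s' hs'] at a1 a2
  rw [dist_comm] at a2
  exact abs_le.2 ⟨by linarith, a1⟩

open Classical in
/-- The number of edge ends at a point. -/
noncomputable def valence [Fintype ι] (N : EdgeParam X ι) (p : X) : ℕ :=
  ∑ i, ((if N.path i 0 = p then 1 else 0) + (if N.path i (N.len i) = p then 1 else 0))

theorem valence_flip [Fintype ι] (N : EdgeParam X ι) (c : ι → Bool) (p : X) :
    (N.flip c).valence p = N.valence p := by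
  unfold valence
  refine Finset.sum_congr rfl fun i _ => ?_
  by_cases h : c i
  · have e0 : (N.flip c).path i 0 = N.path i (N.len i) := by simp [EdgeParam.flip, h]
    have e1 : (N.flip c).path i ((N.flip c).len i) = N.path i 0 := by simp [EdgeParam.flip, h]
    rw [e0, e1, add_comm]
  · have e0 : (N.flip c).path i 0 = N.path i 0 := by simp [EdgeParam.flip, h]
    have e1 : (N.flip c).path i ((N.flip c).len i) = N.path i (N.len i) := by
      simp [EdgeParam.flip, h]
    rw [e0, e1]

/-- No vertex has valence two. -/
def Reduced [Fintype ι] (N : EdgeParam X ι) : Prop :=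
  ∀ i, N.valence (N.path i 0) ≠ 2 ∧ N.valence (N.path i (N.len i)) ≠ 2

theorem Reduced.flip [Fintype ι] {N : EdgeParam X ι} (h : N.Reduced) (c : ι → Bool) :
    (N.flip c).Reduced := by
  intro i
  rw [valence_flip, valence_flip]
  simp only [EdgeParam.flip]
  by_cases hc : c i
  · simpa [hc] using (h i).symm
  · simpa [hc] using h i

/-- The end of the edge `e.1` at which the parameter is `0` (`e.2 = false`) or maximal. -/
def endpt (N : EdgeParam X ι) (e : ι × Bool) : X :=
  if e.2 then N.path e.1 (N.len e.1) else N.path e.1 0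

open Classical in
theorem valence_eq_card [Fintype ι] (N : EdgeParam X ι) (p : X) :
    N.valence p = (Finset.univ.filter fun e : ι × Bool => N.endpt e = p).card := by
  rw [Finset.card_filter, Fintype.sum_prod_type]
  refine Finset.sum_congr rfl fun i _ => ?_
  rw [Fintype.sum_bool, add_comm]
  simp [endpt]

/-- Merge two edges at a vertex where no other edge ends. -/
noncomputable def merge [DecidableEq ι] (N : EdgeParam X ι) (i₁ i₂ : ι) (hne : i₁ ≠ i₂) (p : X)
    (e1 : N.path i₁ (N.len i₁) = p) (e2 : N.path i₂ 0 = p)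
    (u1 : ∀ i, N.path i (N.len i) = p → i = i₁) (u2 : ∀ i, N.path i 0 = p → i = i₂) :
    EdgeParam X {i // i ≠ i₂} where
  len i := if i.1 = i₁ then N.len i₁ + N.len i₂ else N.len i
  -- The inequality is strict, so the junction itself belongs to the first edge; `e1` and `e2` make
  -- this choice harmless.
  path i s := if i.1 = i₁ ∧ N.len i₁ < s then N.path i₂ (s - N.len i₁) else N.path i s
  len_pos i := by
    have := N.len_pos i₁
    have := N.len_pos i₂
    have := N.len_pos i
    split_ifs <;> linarith
  cover x := by
    obtain ⟨i, s, hs, h⟩ := N.cover x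
    have p1 := N.len_pos i₁
    have p2 := N.len_pos i₂
    by_cases hi2 : i = i₂
    · subst hi2
      rcases eq_or_lt_of_le hs.1 with h0 | h0
      · refine ⟨⟨i₁, hne⟩, N.len i₁, ⟨p1.le, by simp [p2.le]⟩, ?_⟩
        simp only [lt_irrefl, and_false, if_false]
        rw [← h, ← h0, e1, e2]
      · refine ⟨⟨i₁, hne⟩, N.len i₁ + s, ⟨by linarith, by simp [hs.2]⟩, ?_⟩
        simp [h0, h]
    · by_cases hi1 : i = i₁
      · subst hi1
        refine ⟨⟨i, hi2⟩, s, ⟨hs.1, by simp; linarith [hs.2]⟩, ?_⟩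
        simp [hs.2, h]
      · exact ⟨⟨i, hi2⟩, s, ⟨hs.1, by simp [hi1, hs.2]⟩, by simp [hi1, h]⟩
  inj := by
    have p1 := N.len_pos i₁
    have p2 := N.len_pos i₂
    have hp : ∀ i, ∀ s ∈ Set.Ioo 0 (N.len i), N.path i s ≠ p := fun i s hs h => by
      obtain ⟨h3, h4⟩ := N.inj i i₁ s hs (N.len i₁) ⟨p1.le, le_rfl⟩ (h.trans e1.symm)
      subst h3
      exact hs.2.ne h4
    have hp' : ∀ i, ∀ s ∈ Set.Icc 0 (N.len i), N.path i s = p →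
        (i = i₁ ∧ s = N.len i₁) ∨ (i = i₂ ∧ s = 0) := fun i s hs h => by
      rcases eq_or_lt_of_le hs.1 with h0 | h0
      · right; subst h0; exact ⟨u2 i h, rfl⟩
      · rcases eq_or_lt_of_le hs.2 with h3 | h3
        · left; subst h3; have := u1 i h; exact ⟨this, by rw [this]⟩
        · exact absurd h (hp i s ⟨h0, h3⟩)
    rintro ⟨i, hi⟩ ⟨j, hj⟩ s ⟨hs1, hs2⟩ s' ⟨hs1', hs2'⟩ h
    dsimp only at hs2 hs2' h
    rw [Subtype.mk.injEq]
    by_cases hB : j = i₁ ∧ N.len i₁ < s'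
    · rw [if_pos hB] at h
      obtain ⟨rfl, hB⟩ := hB
      rw [if_pos rfl] at hs2'
      by_cases hA : i = j ∧ N.len j < s
      · rw [if_pos hA] at h
        obtain ⟨rfl, hA⟩ := hA
        rw [if_pos rfl] at hs2
        obtain ⟨-, h4⟩ := N.inj _ _ _ ⟨by linarith, by linarith⟩ _ ⟨by linarith, by linarith⟩ h
        exact ⟨rfl, by linarith⟩
      · rw [if_neg hA] at h
        by_cases hsi : s < N.len i
        · exact absurd (N.inj _ _ _ ⟨hs1, hsi⟩ _ ⟨by linarith, by linarith⟩ h).1 hi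
        · by_cases hij : i = j
          · subst hij
            have : s = N.len i := le_antisymm (by by_contra hc; exact hA ⟨rfl, by linarith⟩)
              (not_lt.1 hsi)
            subst this
            rcases hp' _ _ ⟨by linarith, by linarith⟩ (h.symm.trans e1) with h5 | h5
            · exact absurd h5.1.symm hi
            · linarith [h5.2]
          · rw [if_neg hij] at hs2
            exact absurd hs2 hsi
    · rw [if_neg hB] at h
      have hs3' : s' ∈ Set.Icc 0 (N.len j) := by
        refine ⟨hs1', ?_⟩
        by_cases hj1 : j = i₁
        · subst hj1; by_contra hc; exact hB ⟨rfl, by linarith⟩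
        · rwa [if_neg hj1] at hs2'
      by_cases hA : i = i₁ ∧ N.len i₁ < s
      · rw [if_pos hA] at h
        obtain ⟨rfl, hA⟩ := hA
        rw [if_pos rfl] at hs2
        exact absurd (N.inj _ _ _ ⟨by linarith, by linarith⟩ _ hs3' h).1.symm hj
      · rw [if_neg hA] at h
        by_cases hsi : s < N.len i
        · exact N.inj _ _ _ ⟨hs1, hsi⟩ _ hs3' h
        · by_cases hij : i = i₁
          · subst hij
            have : s = N.len i := le_antisymm (by by_contra hc; exact hA ⟨rfl, by linarith⟩)
              (not_lt.1 hsi)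
            subst this
            rcases hp' _ _ hs3' (h.symm.trans e1) with h5 | h5
            · exact ⟨h5.1.symm, h5.2.symm⟩
            · exact absurd h5.1 hj
          · rw [if_neg hij] at hs2
            exact absurd hs2 hsi
  dist_le := by
    have p1 := N.len_pos i₁
    have p2 := N.len_pos i₂
    have key : ∀ s s', 0 ≤ s → s ≤ N.len i₁ → N.len i₁ < s' → s' ≤ N.len i₁ + N.len i₂ →
        dist (N.path i₁ s) (N.path i₂ (s' - N.len i₁)) ≤ s' - s := fun s s' h1 h2 h3 h4 => by
      have a := N.dist_le i₁ s ⟨h1, h2⟩ (N.len i₁) ⟨p1.le, le_rfl⟩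
      have b := N.dist_le i₂ 0 ⟨le_rfl, p2.le⟩ (s' - N.len i₁) ⟨by linarith, by linarith⟩
      rw [e1, abs_of_nonpos (by linarith)] at a
      rw [e2, abs_of_nonpos (by linarith)] at b
      linarith [dist_triangle (N.path i₁ s) p (N.path i₂ (s' - N.len i₁))]
    rintro ⟨i, hi⟩ s ⟨hs1, hs2⟩ s' ⟨hs1', hs2'⟩
    dsimp only at hs2 hs2' ⊢
    by_cases hij : i = i₁
    · subst hij
      simp only [if_true, true_and] at hs2 hs2' ⊢
      split_ifs with h1 h2 h2
      · refine (N.dist_le i₂ _ ⟨by linarith, by linarith⟩ _ ⟨by linarith, by linarith⟩).trans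
          (le_of_eq ?_)
        congr 1; ring
      · rw [dist_comm, abs_of_nonneg (by linarith)]
        exact key s' s hs1' (by linarith) h1 hs2
      · rw [abs_of_nonpos (by linarith), neg_sub]
        exact key s s' hs1 (by linarith) h2 hs2'
      · exact N.dist_le _ _ ⟨hs1, by linarith⟩ _ ⟨hs1', by linarith⟩
    · simp only [hij, if_false, false_and] at hs2 hs2' ⊢
      exact N.dist_le _ _ ⟨hs1, hs2⟩ _ ⟨hs1', hs2'⟩
  sub_le_dist F hF := by
    have p1 := N.len_pos i₁
    have p2 := N.len_pos i₂
    refine N.sub_le_dist F fun i s hs s' hs' => ?_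
    have hG := hF ⟨i₁, hne⟩
    simp only [if_true, true_and] at hG
    by_cases hi2 : i = i₂
    · subst hi2
      have key : ∀ t ∈ Set.Icc 0 (N.len i), (if N.len i₁ < t + N.len i₁ then
          N.path i (t + N.len i₁ - N.len i₁) else N.path i₁ (t + N.len i₁)) = N.path i t := by
        rintro t ⟨h1, h2⟩
        rcases eq_or_lt_of_le h1 with h | h
        · subst h; simp [e1, e2]
        · simp [h]
      have := hG (s + N.len i₁) ⟨by linarith [hs.1], by linarith [hs.2]⟩ (s' + N.len i₁)
        ⟨by linarith [hs'.1], by linarith [hs'.2]⟩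
      rwa [key s hs, key s' hs', add_sub_add_right_eq_sub] at this
    · by_cases hi1 : i = i₁
      · subst hi1
        have := hG s ⟨hs.1, by linarith [hs.2]⟩ s' ⟨hs'.1, by linarith [hs'.2]⟩
        rwa [if_neg (not_lt.2 hs.2), if_neg (not_lt.2 hs'.2)] at this
      · have := hF ⟨i, hi2⟩ s
        simp only [hi1, if_false, false_and] at this
        exact this hs s' hs'

end EdgeParam

/-! ### Elimination of vertices of valence two -/

namespace EdgeParam

variable {X : Type*} [MetricSpace X] {ι : Type}

/-- A loop at a vertex where no other edge ends is the whole space. -/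
theorem eq_path_of_loop (N : EdgeParam X ι) (i : ι) (h : N.path i 0 = N.path i (N.len i))
    (hu : ∀ j, N.path j 0 = N.path i 0 ∨ N.path j (N.len j) = N.path i 0 → j = i) (x : X) :
    ∃ s ∈ Set.Icc 0 (N.len i), N.path i s = x := by
  classical
  have hi := N.len_pos i
  by_contra hx
  -- If the loop missed `x`, this function would be constant on every edge, hence `1`-Lipschitz, yet
  -- jump by more than the distance from `x` to the base point.
  let F : X → ℝ := fun y => if ∃ s ∈ Set.Icc 0 (N.len i), N.path i s = y then 0
    else dist x (N.path i 0) + 1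
  have hF : ∀ j, ∀ s ∈ Set.Icc 0 (N.len j), ∀ s' ∈ Set.Icc 0 (N.len j),
      F (N.path j s) - F (N.path j s') ≤ |s - s'| := by
    intro j s hs s' hs'
    have key : F (N.path j s) = F (N.path j s') := by
      by_cases hj : j = i
      · subst hj
        simp only [F]
        rw [if_pos ⟨s, hs, rfl⟩, if_pos ⟨s', hs', rfl⟩]
      · have A : ∀ s ∈ Set.Icc 0 (N.len j),
            ¬ ∃ t ∈ Set.Icc 0 (N.len i), N.path i t = N.path j s := by
          rintro s hs ⟨t, ht, hts⟩
          by_cases hsj : s ∈ Set.Ioo 0 (N.len j)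
          · exact hj (N.inj j i s hsj t ht hts.symm).1
          by_cases hti : t ∈ Set.Ioo 0 (N.len i)
          · exact hj (N.inj i j t hti s hs hts).1.symm
          have e1 : N.path i t = N.path i 0 := by
            rcases eq_or_lt_of_le ht.1 with h1 | h1
            · rw [← h1]
            · rcases eq_or_lt_of_le ht.2 with h2 | h2
              · rw [h2, h]
              · exact absurd ⟨h1, h2⟩ hti
          rw [e1] at hts
          rcases eq_or_lt_of_le hs.1 with h1 | h1
          · exact hj (hu j (Or.inl (by rw [hts, h1])))
          · rcases eq_or_lt_of_le hs.2 with h2 | h2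
            · exact hj (hu j (Or.inr (by rw [hts, ← h2])))
            · exact hsj ⟨h1, h2⟩
        simp only [F]
        rw [if_neg (A s hs), if_neg (A s' hs')]
    rw [key, sub_self]
    exact abs_nonneg _
  have := N.sub_le_dist F hF x (N.path i 0)
  simp only [F] at this
  rw [if_neg hx, if_pos ⟨0, ⟨le_rfl, hi.le⟩, rfl⟩] at this
  linarith

/-- A single loop is isometric to a circle. -/
theorem exists_isometry_addCircle (N : EdgeParam X ι) (i : ι)
    (h : N.path i 0 = N.path i (N.len i))
    (hs : ∀ x, ∃ s ∈ Set.Icc 0 (N.len i), N.path i s = x) :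
    ∃ f : X → AddCircle (N.len i), Isometry f ∧ Function.Surjective f := by
  have hi := N.len_pos i
  have : Fact (0 < N.len i) := ⟨hi⟩
  choose c hc hcx using hs
  let f : X → AddCircle (N.len i) := fun x => (c x : AddCircle (N.len i))
  have hf : ∀ s ∈ Set.Icc 0 (N.len i), f (N.path i s) = (s : AddCircle (N.len i)) := by
    intro s hs
    have h1 := hc (N.path i s)
    have h2 := hcx (N.path i s)
    simp only [f]
    set t := c (N.path i s)
    by_cases hsi : s ∈ Set.Ioo 0 (N.len i)
    · rw [(N.inj i i s hsi t h1 h2.symm).2]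
    by_cases hti : t ∈ Set.Ioo 0 (N.len i)
    · rw [(N.inj i i t hti s hs h2).2]
    have A : ∀ s ∈ Set.Icc 0 (N.len i), s ∉ Set.Ioo 0 (N.len i) → (s : AddCircle (N.len i)) = 0 := by
      intro s hs hsi
      rcases eq_or_lt_of_le hs.1 with h1 | h1
      · rw [← h1]; simp
      · rcases eq_or_lt_of_le hs.2 with h2 | h2
        · rw [h2]; exact AddCircle.coe_period _
        · exact absurd ⟨h1, h2⟩ hsi
    rw [A s hs hsi, A t h1 hti]
  have hdist : ∀ s t : ℝ, dist (s : AddCircle (N.len i)) t ≤ |s - t| := fun s t => by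
    rw [dist_eq_norm, ← AddCircle.coe_sub]
    exact QuotientAddGroup.norm_mk_le_norm
  have key : ∀ s t, 0 ≤ s → s ≤ t → t ≤ N.len i →
      dist (N.path i s) (N.path i t) ≤ dist (s : AddCircle (N.len i)) t := by
    intro s t h1 h2 h3
    rw [dist_comm (s : AddCircle (N.len i)), dist_eq_norm, ← AddCircle.coe_sub]
    -- The two cases are the two arcs between the points: the direct one, and the one through the
    -- base point of the loop.
    by_cases hst : t - s ≤ N.len i / 2
    · rw [(AddCircle.norm_coe_eq_abs_iff (N.len i) hi.ne').2
        (by rw [abs_of_nonneg (by linarith), abs_of_pos hi]; exact hst), abs_sub_comm]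
      exact N.dist_le i s ⟨h1, by linarith⟩ t ⟨by linarith, h3⟩
    · have e : ((t - s : ℝ) : AddCircle (N.len i)) = ((t - s - N.len i : ℝ) : AddCircle (N.len i)) := by
        rw [AddCircle.coe_sub _ (t - s), AddCircle.coe_period, sub_zero]
      rw [e, (AddCircle.norm_coe_eq_abs_iff (N.len i) hi.ne').2
        (by rw [abs_of_nonpos (by linarith), abs_of_pos hi]; linarith), abs_of_nonpos (by linarith)]
      have a1 := N.dist_le i s ⟨h1, by linarith⟩ 0 ⟨le_rfl, hi.le⟩
      have a2 := N.dist_le i (N.len i) ⟨hi.le, le_rfl⟩ t ⟨by linarith, h3⟩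
      rw [abs_of_nonneg (by linarith)] at a1 a2
      rw [← h] at a2
      linarith [dist_triangle (N.path i s) (N.path i 0) (N.path i t)]
  refine ⟨f, Isometry.of_dist_eq fun x y => le_antisymm ?_ ?_, fun z => ?_⟩
  -- The upper bound is maximality of the metric, applied to the circle distance to `f y`.
  · have := N.sub_le_dist (fun z => dist (f z) (f y)) (fun j s hs s' hs' => ?_) x y
    · simpa using this
    · have hj : j = i := by
        obtain ⟨hp1, hp2⟩ : N.len j / 2 ∈ Set.Ioo 0 (N.len j) :=
          ⟨half_pos (N.len_pos j), half_lt_self (N.len_pos j)⟩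
        exact (N.inj j i _ ⟨hp1, hp2⟩ _ (hc (N.path j (N.len j / 2))) (hcx _).symm).1
      subst hj
      rw [hf s hs, hf s' hs']
      have := dist_triangle (s : AddCircle (N.len j)) s' (f y)
      linarith [hdist s s']
  · have := hc x
    have := hc y
    rcases le_total (c x) (c y) with h1 | h1
    · have := key (c x) (c y) (hc x).1 h1 (hc y).2
      rwa [hcx, hcx] at this
    · have := key (c y) (c x) (hc y).1 h1 (hc x).2
      rw [hcx, hcx] at this
      rw [dist_comm x y, dist_comm (f x)]
      exact this
  · obtain ⟨t, ht, rfl⟩ := (AddCircle.coe_image_Icc_eq (N.len i) 0 ▸ Set.mem_univ z :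
      z ∈ ((↑) : ℝ → AddCircle (N.len i)) '' Set.Icc 0 (0 + N.len i))
    rw [zero_add] at ht
    exact ⟨N.path i t, hf t ht⟩

theorem _root_.Isometry.isMMIsomorphism_uniformMeasure {X Y : Type*} [MetricSpace X]
    [MeasurableSpace X] [BorelSpace X] [MetricSpace Y] [MeasurableSpace Y] [BorelSpace Y]
    {f : X → Y} (hf : Isometry f) (hs : Function.Surjective f) :
    IsMMIsomorphism (uniformMeasure X) (uniformMeasure Y) f := by
  refine ⟨⟨hf.continuous.measurable, ?_⟩, hf, hs⟩
  have h1 := hf.map_hausdorffMeasure (d := 1) (Or.inl zero_le_one)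
  rw [hs.range_eq, Measure.restrict_univ] at h1
  have h2 := hf.hausdorffMeasure_image (d := 1) (Or.inl zero_le_one) Set.univ
  rw [Set.image_univ, hs.range_eq] at h2
  rw [uniformMeasure, uniformMeasure, Measure.map_smul, h1, h2]

/-- Induction on the number of edges. At a vertex of valence two, either both ends belong to one
edge, which is then a loop filling the space, or two distinct edges meet and can be merged. -/
theorem isCircleGraph_or_exists_reduced [MeasurableSpace X] [BorelSpace X] (n : ℕ) :
    ∀ (ι : Type) [Fintype ι], Fintype.card ι = n → EdgeParam X ι →
      IsCircleGraph X ∨ ∃ (κ : Type) (_ : Fintype κ) (N : EdgeParam X κ), N.Reduced := by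
  classical
  induction n with
  | zero =>
    intro ι _ hn N
    have := Fintype.card_eq_zero_iff.1 hn
    exact Or.inr ⟨ι, inferInstance, N, fun i => isEmptyElim i⟩
  | succ n ih =>
    intro ι _ hn N
    by_cases hr : N.Reduced
    · exact Or.inr ⟨ι, inferInstance, N, hr⟩
    obtain ⟨p, hp⟩ : ∃ p, N.valence p = 2 := by
      by_contra hc
      push Not at hc
      exact hr fun i => ⟨hc _, hc _⟩
    rw [valence_eq_card, Finset.card_eq_two] at hp
    obtain ⟨⟨i, b⟩, ⟨j, b'⟩, hne, hp⟩ := hp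
    have hmem : ∀ e, N.endpt e = p ↔ e = (i, b) ∨ e = (j, b') := fun e => by
      have := congrArg (e ∈ ·) hp
      simpa using this
    have h1 := (hmem (i, b)).2 (Or.inl rfl)
    have h2 := (hmem (j, b')).2 (Or.inr rfl)
    by_cases hij : i = j
    · subst hij
      left
      have hall : ∀ c, N.endpt (i, c) = p := by
        intro c
        have hbb : b ≠ b' := fun h => hne (by rw [h])
        by_cases hcb : c = b
        · rw [hcb, h1]
        · have : c = b' := by cases c <;> cases b <;> cases b' <;> simp_all
          rw [this, h2]
      have e0 : N.path i 0 = p := by simpa [endpt] using hall false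
      have e1 : N.path i (N.len i) = p := by simpa [endpt] using hall true
      obtain ⟨f, hf, hfs⟩ := N.exists_isometry_addCircle i (e0.trans e1.symm)
        (N.eq_path_of_loop i (e0.trans e1.symm) (by
          rw [e0]
          rintro k (hk | hk)
          · rcases (hmem (k, false)).1 (by simpa [endpt] using hk) with h | h <;>
              exact congrArg Prod.fst h
          · rcases (hmem (k, true)).1 (by simpa [endpt] using hk) with h | h <;>
              exact congrArg Prod.fst h))
      exact ⟨N.len i, N.len_pos i, f, hf.isMMIsomorphism_uniformMeasure hfs⟩
    -- Orient the two edges so that `i` ends at `p` and `j` starts there; other orientations are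
    -- chosen arbitrarily.
    · let c : ι → Bool := fun k => if k = i then !b else b'
      have e1 : (N.flip c).path i ((N.flip c).len i) = p := by
        rw [← h1]
        cases b <;> simp [EdgeParam.flip, c, endpt]
      have e2 : (N.flip c).path j 0 = p := by
        rw [← h2]
        cases b' <;> simp [EdgeParam.flip, c, endpt, Ne.symm hij]
      have e3 : ∀ k, (N.flip c).path k ((N.flip c).len k) = N.endpt (k, !c k) := fun k => by
        cases h : c k <;> simp [EdgeParam.flip, endpt, h]
      have e4 : ∀ k, (N.flip c).path k 0 = N.endpt (k, c k) := fun k => by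
        cases h : c k <;> simp [EdgeParam.flip, endpt, h]
      refine ih {k // k ≠ j} ?_ ((N.flip c).merge i j hij p e1 e2 ?_ ?_)
      · rw [Fintype.card_subtype_compl, Fintype.card_subtype_eq, hn]; rfl
      · intro k hk
        rw [e3, hmem] at hk
        rcases hk with hk | hk
        · exact congrArg Prod.fst hk
        · by_contra hki
          have a1 := congrArg Prod.fst hk
          have a2 := congrArg Prod.snd hk
          simp [c, hki] at a2
      · intro k hk
        rw [e4, hmem] at hk
        rcases hk with hk | hk
        · have a1 := congrArg Prod.fst hk
          have a2 := congrArg Prod.snd hk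
          simp only at a1
          subst a1
          simp [c] at a2
        · exact congrArg Prod.fst hk

end EdgeParam

/-! ### Length measure and the length of small balls -/

namespace EdgeParam

variable {X : Type*} [MetricSpace X] {ι : Type}

/-- The edge without its ends. -/
def openEdge (N : EdgeParam X ι) (i : ι) : Set X := N.path i '' Set.Ioo 0 (N.len i)

theorem continuous_of_sub_le_dist {F : X → ℝ} (hF : ∀ x y, F x - F y ≤ dist x y) :
    Continuous F := by
  refine (LipschitzWith.of_dist_le_mul (K := 1) fun x y => ?_).continuous
  rw [NNReal.coe_one, one_mul, Real.dist_eq, abs_le]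
  have := hF y x
  rw [dist_comm] at this
  exact ⟨by linarith, hF x y⟩

theorem isOpen_openEdge (N : EdgeParam X ι) (i : ι) : IsOpen (N.openEdge i) := by
  obtain ⟨F, h1, h2, h3⟩ := N.exists_tent i
  -- The open edge is where its tent function is positive.
  have : N.openEdge i = {x | 0 < F x} := by
    ext x
    constructor
    · rintro ⟨s, hs, rfl⟩
      rw [Set.mem_ofPred_eq, h1 s ⟨hs.1.le, hs.2.le⟩]
      exact lt_min hs.1 (by linarith [hs.2])
    · intro hx
      obtain ⟨j, s, hs, rfl⟩ := N.cover x
      rw [Set.mem_ofPred_eq] at hx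
      by_cases hj : j = i
      · subst hj
        rw [h1 s hs, lt_min_iff] at hx
        exact ⟨s, ⟨hx.1, by linarith⟩, rfl⟩
      · rw [h2 j hj s hs] at hx
        exact absurd hx (lt_irrefl _)
  rw [this]
  exact isOpen_lt continuous_const (continuous_of_sub_le_dist h3)

theorem disjoint_openEdge (N : EdgeParam X ι) {i j : ι} (hij : i ≠ j) :
    Disjoint (N.openEdge i) (N.openEdge j) := by
  rw [Set.disjoint_left]
  rintro _ ⟨s, hs, rfl⟩ ⟨t, ht, h⟩
  exact hij (N.inj i j s hs t ⟨ht.1.le, ht.2.le⟩ h.symm).1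

/-- The vertices. -/
def vertices (N : EdgeParam X ι) : Set X := Set.range N.endpt

theorem finite_vertices [Finite ι] (N : EdgeParam X ι) : N.vertices.Finite := Set.finite_range _

theorem mem_vertices_or (N : EdgeParam X ι) (x : X) : x ∈ N.vertices ∨ ∃ i, x ∈ N.openEdge i := by
  obtain ⟨i, s, hs, rfl⟩ := N.cover x
  rcases eq_or_lt_of_le hs.1 with h | h
  · exact Or.inl ⟨(i, false), by simp [endpt, ← h]⟩
  · rcases eq_or_lt_of_le hs.2 with h' | h'
    · exact Or.inl ⟨(i, true), by simp [endpt, ← h']⟩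
    · exact Or.inr ⟨i, s, ⟨h, h'⟩, rfl⟩

theorem continuousOn_path (N : EdgeParam X ι) (i : ι) :
    ContinuousOn (N.path i) (Set.Icc 0 (N.len i)) :=
  (LipschitzOnWith.of_dist_le_mul (K := 1) fun s hs s' hs' => by
    rw [NNReal.coe_one, one_mul, Real.dist_eq]
    exact N.dist_le i s hs s' hs').continuousOn

theorem min_sub_min_le {a b a' b' c : ℝ} (h1 : a - a' ≤ c) (h2 : b - b' ≤ c) :
    min a b - min a' b' ≤ c := by
  have : min a b ≤ min (a' + c) (b' + c) := min_le_min (by linarith) (by linarith)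
  rw [min_add_add_right] at this
  linarith

variable [MeasurableSpace X] [BorelSpace X]

theorem hausdorffMeasure_image_le (N : EdgeParam X ι) (i : ι) {S : Set ℝ}
    (hS : S ⊆ Set.Icc 0 (N.len i)) : μH[1] (N.path i '' S) ≤ volume S := by
  have : LipschitzOnWith 1 (N.path i) S := LipschitzOnWith.of_dist_le_mul fun s hs s' hs' => by
    rw [NNReal.coe_one, one_mul, Real.dist_eq]
    exact N.dist_le i s (hS hs) s' (hS hs')
  simpa [hausdorffMeasure_real] using this.hausdorffMeasure_image_le zero_le_one

theorem hausdorffMeasure_image_halves (N : EdgeParam X ι) (a : ι × Bool) {S : Set ℝ}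
    (hS : S ⊆ Set.Icc 0 (N.halves.len a)) : μH[1] (N.halves.path a '' S) = volume S := by
  refine le_antisymm (N.halves.hausdorffMeasure_image_le a hS) ?_
  let f : Set.Icc 0 (N.halves.len a) → X := fun s => N.halves.path a s
  have hf : Isometry f := Isometry.of_dist_eq fun s s' => by
    rw [N.dist_path_halves a s s.2 s' s'.2, Subtype.dist_eq, Real.dist_eq]
  obtain ⟨T, rfl⟩ : ∃ T : Set (Set.Icc 0 (N.halves.len a)), S = Subtype.val '' T :=
    ⟨Subtype.val ⁻¹' S, by simpa using hS⟩
  rw [← hausdorffMeasure_real, isometry_subtype_coe.hausdorffMeasure_image (Or.inl zero_le_one),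
    ← hf.hausdorffMeasure_image (Or.inl zero_le_one), Set.image_image]

theorem hausdorffMeasure_finite_eq_zero {S : Set X} (hS : S.Finite) : μH[1] S = 0 := by
  have := nullSingletonClass_hausdorff (X := X) (d := 1) one_pos
  exact hS.measure_zero _

/-- The open half edges are disjoint and cover all but finitely many points, and each is isometric
to an interval. -/
theorem hausdorffMeasure_eq_sum_halves [Fintype ι] (N : EdgeParam X ι) {A : Set X}
    (hA : MeasurableSet A) :
    μH[1] A = ∑ a, volume (Set.Ioo 0 (N.halves.len a) ∩ N.halves.path a ⁻¹' A) := by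
  have h1 : μH[1] A = μH[1] (⋃ a, A ∩ N.halves.openEdge a) := by
    refine measure_congr ?_
    rw [← Set.inter_iUnion]
    refine (Filter.EventuallyLE.antisymm (LE.le.eventuallyLE Set.inter_subset_left)
      ?_).symm
    rw [ae_le_set]
    refine measure_mono_null (t := N.halves.vertices) ?_
      (hausdorffMeasure_finite_eq_zero N.halves.finite_vertices)
    rintro x ⟨hx, hx'⟩
    rcases N.halves.mem_vertices_or x with h | ⟨a, h⟩
    · exact h
    · exact absurd ⟨hx, Set.mem_iUnion.2 ⟨a, h⟩⟩ hx'
  rw [h1, measure_iUnion _ fun a => hA.inter (N.halves.isOpen_openEdge a).measurableSet,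
    tsum_fintype]
  · refine Finset.sum_congr rfl fun a _ => ?_
    rw [← N.hausdorffMeasure_image_halves a
      (Set.inter_subset_left.trans Set.Ioo_subset_Icc_self), Set.image_inter_preimage,
      Set.inter_comm, openEdge]
  · intro a b hab
    exact (N.halves.disjoint_openEdge hab).mono Set.inter_subset_right Set.inter_subset_right

theorem volume_Ioo_inter_eq_halves (l : ℝ) (P : Set ℝ) :
    volume (Set.Ioo 0 l ∩ P) = volume (Set.Ioo 0 (l / 2) ∩ P) +
      volume (Set.Ioo 0 (l / 2) ∩ (fun s => l - s) ⁻¹' P) := by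
  rw [← measure_inter_add_sdiff (Set.Ioo 0 l ∩ P) (measurableSet_Iic (a := l / 2))]
  congr 1
  · refine measure_congr ?_
    have h1 : Set.Ioo 0 l ∩ P ∩ Set.Iic (l / 2) = Set.Ioc 0 (l / 2) ∩ P := by
      ext s
      simp only [Set.mem_inter_iff, Set.mem_Ioo, Set.mem_Iic, Set.mem_Ioc]
      constructor
      · rintro ⟨⟨⟨h1, h2⟩, h3⟩, h4⟩; exact ⟨⟨h1, h4⟩, h3⟩
      · rintro ⟨⟨h1, h4⟩, h3⟩; exact ⟨⟨⟨h1, by linarith⟩, h3⟩, h4⟩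
    rw [h1]
    exact Ioo_ae_eq_Ioc.symm.inter (Filter.EventuallyEq.refl _ _)
  · rw [← (measurePreserving_sub_left volume l).measure_preimage_equiv
      (f := MeasurableEquiv.subLeft l) ((Set.Ioo 0 l ∩ P) \ Set.Iic (l / 2))]
    congr 1
    ext s
    have e : MeasurableEquiv.subLeft l s = l - s := rfl
    simp only [Set.mem_inter_iff, Set.mem_Ioo, Set.mem_Iic, Set.mem_preimage, Set.mem_sdiff, e]
    constructor
    · rintro ⟨⟨⟨h1, h2⟩, h3⟩, h4⟩; exact ⟨⟨by linarith, by linarith⟩, h3⟩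
    · rintro ⟨⟨h1, h4⟩, h3⟩; exact ⟨⟨⟨by linarith, by linarith⟩, h3⟩, by linarith⟩

theorem hausdorffMeasure_eq_sum [Fintype ι] (N : EdgeParam X ι) {A : Set X}
    (hA : MeasurableSet A) :
    μH[1] A = ∑ i, volume (Set.Ioo 0 (N.len i) ∩ N.path i ⁻¹' A) := by
  rw [N.hausdorffMeasure_eq_sum_halves hA, Fintype.sum_prod_type]
  refine Finset.sum_congr rfl fun i _ => ?_
  rw [Fintype.sum_bool, volume_Ioo_inter_eq_halves (N.len i), add_comm]
  rfl

theorem hausdorffMeasure_univ [Fintype ι] (N : EdgeParam X ι) :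
    μH[1] (Set.univ : Set X) = ENNReal.ofReal (∑ i, N.len i) := by
  rw [N.hausdorffMeasure_eq_sum MeasurableSet.univ,
    ENNReal.ofReal_sum_of_nonneg fun i _ => (N.len_pos i).le]
  simp

theorem hausdorffMeasure_real_eq_sum [Fintype ι] (N : EdgeParam X ι) {A : Set X}
    (hA : MeasurableSet A) :
    (μH[1] : Measure X).real A = ∑ i, volume.real (Set.Ioo 0 (N.len i) ∩ N.path i ⁻¹' A) := by
  rw [Measure.real, N.hausdorffMeasure_eq_sum hA, ENNReal.toReal_sum]
  · rfl
  · intro i _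
    refine ((measure_mono Set.inter_subset_left).trans_lt ?_).ne
    simp

/-- The set is the trace of a small ball on an edge: one interval around the center or next to the
start, and one segment entering from the far end. -/
theorem volume_real_Ioo_inter {l p q c : ℝ} (hq : q ≤ l) (hqc : q < c) (hc : 0 < c) :
    volume.real (Set.Ioo 0 l ∩ {s | (p ≤ s ∧ s ≤ q) ∨ c ≤ s}) =
      max (q - max 0 p) 0 + max (l - c) 0 := by
  have h : Set.Ioo 0 l ∩ {s | (p ≤ s ∧ s ≤ q) ∨ c ≤ s} =
      (Set.Ioo 0 l ∩ Set.Icc p q) ∪ Set.Ico c l := by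
    ext s
    simp only [Set.mem_inter_iff, Set.mem_Ioo, Set.mem_ofPred_eq, Set.mem_union, Set.mem_Icc,
      Set.mem_Ico]
    constructor
    · rintro ⟨h1, h2 | h2⟩
      · exact Or.inl ⟨h1, h2⟩
      · exact Or.inr ⟨h2, h1.2⟩
    · rintro (⟨h1, h2⟩ | ⟨h1, h2⟩)
      · exact ⟨h1, Or.inl h2⟩
      · exact ⟨⟨hc.trans_le h1, h2⟩, Or.inr h1⟩
  have h' : volume.real (Set.Ioo 0 l ∩ Set.Icc p q) = volume.real (Set.Icc (max 0 p) q) := by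
    have : Set.Icc 0 l ∩ Set.Icc p q = Set.Icc (max 0 p) q := by
      rw [Set.Icc_inter_Icc, inf_eq_right.2 hq]
    rw [← this]
    exact measureReal_congr (Ioo_ae_eq_Icc.inter (Filter.EventuallyEq.refl _ _))
  have hfin : volume (Set.Ioo 0 l ∩ Set.Icc p q) ≠ ⊤ :=
    ((measure_mono Set.inter_subset_right).trans_lt (by simp)).ne
  rw [h, measureReal_union _ measurableSet_Ico hfin (by simp), h', Real.volume_real_Icc,
    Real.volume_real_Ico]
  rw [Set.disjoint_left]
  rintro s ⟨-, h1⟩ ⟨h2, -⟩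
  linarith [h1.2]

open Classical in
/-- The measure of balls centered on the half edge next to the start of the edge `i`, with radii
slightly larger than the distance to this start. -/
theorem exists_measure_closedBall [Fintype ι] (N : EdgeParam X ι) (i : ι) {t : ℝ} (ht : 0 < t)
    (ht' : t < N.len i / 2) : ∃ R > t, ∀ r, 0 ≤ r → r < R →
      (μH[1] : Measure X).real (Metric.closedBall (N.path i t) r) =
        2 * r + (N.valence (N.path i 0) - 2) * max (r - t) 0 := by
  -- The bound `δ` keeps the ball of radius less than `t + δ` from reaching the midpoint of `i` from
  -- `t`, and parts entering one edge from its two ends from meeting.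
  obtain ⟨δ, hδ, hδl, hδi⟩ : ∃ δ > 0, (∀ j, δ ≤ N.len j / 2) ∧ δ ≤ N.len i / 2 - t := by
    have : Nonempty ι := ⟨i⟩
    obtain ⟨k, hk⟩ := Finite.exists_min N.len
    refine ⟨min (N.len k / 2) (N.len i / 2 - t), lt_min (half_pos (N.len_pos k)) (by linarith),
      fun j => (min_le_left _ _).trans (by linarith [hk j]), min_le_right _ _⟩
  set R := t + δ with hR
  set u := N.path i 0 with hu
  -- `v` on vertices and `g` on edges describe the distance to the center truncated at `R`. Within
  -- this radius `u` is the only vertex reached, but several edge ends, including the far end of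
  -- `i`, may lie at `u`.
  let v : X → ℝ := fun y => if y = u then t else R
  have hvt : ∀ y, t ≤ v y := fun y => by simp only [v]; split_ifs <;> linarith
  have hvR : ∀ y, v y ≤ R := fun y => by simp only [v]; split_ifs <;> linarith
  have hvu : ∀ y, v y < R → y = u := fun y h => by
    by_contra hc
    simp [v, hc] at h
  let g : ι → ℝ → ℝ := fun j s => min R (min (if j = i then |s - t| else v (N.path j 0) + s)
    (v (N.path j (N.len j)) + (N.len j - s)))
  have hvu' : v u = t := by simp [v]
  obtain ⟨F, hF, hF'⟩ := N.exists_lipschitz_glue g v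
    (fun j => by
      have h1 := hvt (N.path j (N.len j))
      have h2 := hδl j
      have h3 := N.len_pos j
      simp only [g]
      split_ifs with h
      · rw [h, ← hu, hvu', zero_sub, abs_neg, abs_of_pos ht, ← h,
          min_eq_left (b := _ + _) (by linarith), min_eq_right (by linarith)]
      · have h4 := hvR (N.path j 0)
        rw [add_zero, min_eq_left (b := _ + _) (by linarith), min_eq_right h4])
    (fun j => by
      have h1 := hvt (N.path j 0)
      have h2 := hδl j
      have h3 := N.len_pos j
      have h4 := hvR (N.path j (N.len j))
      simp only [g]
      rw [sub_self, add_zero]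
      split_ifs with h
      · subst h
        rw [abs_of_nonneg (by linarith), min_eq_right (a := _ - _) (by linarith), min_eq_right h4]
      · rw [min_eq_right (b := v _) (by linarith), min_eq_right h4])
    (fun j s s' => by
      have h1 := le_abs_self (s - s')
      have h2 := neg_abs_le (s - s')
      refine min_sub_min_le (by simp) (min_sub_min_le ?_ (by linarith))
      split_ifs with h
      · refine (abs_sub_abs_le_abs_sub _ _).trans (le_of_eq ?_)
        congr 1; ring
      · linarith)
  have hti : t ∈ Set.Icc 0 (N.len i) := ⟨ht.le, by linarith⟩
  have hFx : F (N.path i t) = 0 := by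
    have h1 := hvt (N.path i (N.len i))
    rw [hF i t hti]
    simp only [g, if_true, sub_self, abs_zero]
    rw [min_eq_left (a := (0 : ℝ)) (by linarith), min_eq_right (by linarith)]
  have hdu : dist (N.path i t) u ≤ t := by
    have := N.dist_le i t hti 0 ⟨le_rfl, by linarith⟩
    rwa [sub_zero, abs_of_pos ht] at this
  have hball : ∀ r < R, ∀ j, ∀ s ∈ Set.Icc 0 (N.len j),
      N.path j s ∈ Metric.closedBall (N.path i t) r ↔ g j s ≤ r := by
    intro r hr j s hs
    have hj := N.len_pos j
    rw [Metric.mem_closedBall]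
    constructor
    · intro h
      have := hF' (N.path j s) (N.path i t)
      rw [hF j s hs, hFx] at this
      linarith
    · intro h
      rcases min_le_iff.1 h with h' | h'
      · linarith
      clear h
      rcases min_le_iff.1 h' with h | h
      · split_ifs at h with hji
        · subst hji
          exact (N.dist_le j s hs t hti).trans h
        · have h1 := hvu (N.path j 0) (by linarith [hs.1])
          rw [h1, hvu'] at h
          have h2 := N.dist_le j s hs 0 ⟨le_rfl, hj.le⟩
          rw [h1, sub_zero, abs_of_nonneg hs.1] at h2
          rw [dist_comm] at hdu
          linarith [dist_triangle (N.path j s) u (N.path i t)]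
      · have h1 := hvu (N.path j (N.len j)) (by linarith [hs.2])
        rw [h1, hvu'] at h
        have h2 := N.dist_le j s hs (N.len j) ⟨hj.le, le_rfl⟩
        rw [h1, abs_of_nonpos (by linarith [hs.2])] at h2
        rw [dist_comm] at hdu
        linarith [dist_triangle (N.path j s) u (N.path i t)]
  refine ⟨R, by linarith, fun r hr0 hr => ?_⟩
  have hw : ∀ y, max (r - v y) 0 = (if y = u then 1 else 0) * max (r - t) 0 := fun y => by
    simp only [v]
    split_ifs
    · simp
    · rw [max_eq_right (by linarith)]; simp
  -- Each edge end at `u` contributes `max (r - t) 0`. The edge `i` has in addition `2 * r`, minus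
  -- the overshoot beyond its start, minus the contribution already counted for that start.
  have hedge : ∀ j, volume.real (Set.Ioo 0 (N.len j) ∩
      N.path j ⁻¹' Metric.closedBall (N.path i t) r) =
      (if N.path j 0 = u then 1 else 0) * max (r - t) 0 +
      (if N.path j (N.len j) = u then 1 else 0) * max (r - t) 0 +
      (if j = i then 2 * r - 2 * max (r - t) 0 else 0) := by
    intro j
    have hj := N.len_pos j
    have h1 := hvt (N.path j (N.len j))
    have h2 := hδl j
    have h3 := hvt (N.path j 0)
    rw [← hw, ← hw]
    by_cases hji : j = i
    · subst hji
      have hset : Set.Ioo 0 (N.len j) ∩ N.path j ⁻¹' Metric.closedBall (N.path j t) r =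
          Set.Ioo 0 (N.len j) ∩ {s | (t - r ≤ s ∧ s ≤ t + r) ∨
            N.len j - (r - v (N.path j (N.len j))) ≤ s} := by
        ext s
        refine and_congr_right fun hs => ?_
        rw [Set.mem_preimage, hball r hr j s ⟨hs.1.le, hs.2.le⟩]
        simp only [g, min_le_iff, not_le.2 hr, false_or, if_true, Set.mem_ofPred_eq, abs_le]
        refine or_congr (and_congr ?_ ?_) ?_ <;> constructor <;> intro h <;> linarith
      rw [hset, volume_real_Ioo_inter (by linarith) (by linarith) (by linarith), sub_sub_cancel,
        if_pos rfl, ← hu, hvu']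
      rcases le_total r t with h | h
      · rw [max_eq_right (a := (0 : ℝ)) (by linarith), max_eq_right (a := r - t) (by linarith),
          max_eq_left (b := (0 : ℝ)) (by linarith)]
        ring
      · rw [max_eq_left (a := (0 : ℝ)) (by linarith), max_eq_left (a := r - t) (by linarith),
          max_eq_left (b := (0 : ℝ)) (by linarith)]
        ring
    · have hset : Set.Ioo 0 (N.len j) ∩ N.path j ⁻¹' Metric.closedBall (N.path i t) r =
          Set.Ioo 0 (N.len j) ∩ {s | (0 ≤ s ∧ s ≤ r - v (N.path j 0)) ∨
            N.len j - (r - v (N.path j (N.len j))) ≤ s} := by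
        ext s
        refine and_congr_right fun hs => ?_
        rw [Set.mem_preimage, hball r hr j s ⟨hs.1.le, hs.2.le⟩]
        simp only [g, min_le_iff, not_le.2 hr, false_or, if_neg hji, Set.mem_ofPred_eq]
        refine or_congr ⟨fun h => ⟨hs.1.le, by linarith⟩, fun h => by linarith [h.2]⟩ ?_
        constructor <;> intro h <;> linarith
      rw [hset, volume_real_Ioo_inter (by linarith) (by linarith) (by linarith), sub_sub_cancel,
        if_neg hji, max_self, sub_zero, add_zero]
  rw [N.hausdorffMeasure_real_eq_sum Metric.isClosed_closedBall.measurableSet,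
    Finset.sum_congr rfl fun j _ => hedge j, Finset.sum_add_distrib, Finset.sum_add_distrib,
    ← Finset.sum_mul, ← Finset.sum_mul, Finset.sum_ite_eq' Finset.univ i, if_pos (Finset.mem_univ _),
    valence]
  push_cast
  rw [Finset.sum_add_distrib]
  ring

end EdgeParam

/-! ### Reading off the distance to a vertex from ball measures -/

namespace EdgeParam

variable {X : Type*} [MetricSpace X] {ι : Type}

theorem total_pos [Fintype ι] [Nonempty ι] (N : EdgeParam X ι) : 0 < ∑ i, N.len i :=
  Finset.sum_pos (fun i _ => N.len_pos i) Finset.univ_nonempty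

variable [MeasurableSpace X] [BorelSpace X]

theorem Reduced.exists_measure_closedBall_halves [Fintype ι] {N : EdgeParam X ι} (hN : N.Reduced)
    (a : ι × Bool) {s : ℝ} (hs : s ∈ Set.Ioo 0 (N.halves.len a)) :
    ∃ k : ℝ, k ≠ 2 ∧ ∃ R > s, ∀ r, 0 ≤ r → r < R →
      (μH[1] : Measure X).real (Metric.closedBall (N.halves.path a s) r) =
        2 * r + (k - 2) * max (r - s) 0 := by
  -- Reversing all edges when `a.2` is true makes the half edge `a` an initial half.
  obtain ⟨R, hR, h⟩ := (N.flip fun _ => a.2).exists_measure_closedBall a.1 hs.1 hs.2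
  exact ⟨_, fun hk => ((hN.flip fun _ => a.2) a.1).1 (by exact_mod_cast hk), R, hR, h⟩

/-- The radius at which the ball measure stops being linear is well defined. -/
theorem le_of_measure_closedBall_eq {f : ℝ → ℝ} {s s' k k' R R' : ℝ} (hs : 0 < s) (hk : k ≠ 2)
    (hR : s < R) (hR' : s' < R')
    (h : ∀ r, 0 ≤ r → r < R → f r = 2 * r + (k - 2) * max (r - s) 0)
    (h' : ∀ r, 0 ≤ r → r < R' → f r = 2 * r + (k' - 2) * max (r - s') 0) : s' ≤ s := by
  by_contra hc
  push Not at hc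
  -- Just beyond `s` the first formula has slope `k`, while the second still has slope `2`.
  obtain ⟨r, hr1, hr2⟩ := exists_between (lt_min hR hc)
  rw [lt_min_iff] at hr2
  have e1 := h r (by linarith) hr2.1
  have e2 := h' r (by linarith) (by linarith)
  rw [max_eq_left (by linarith)] at e1
  rw [max_eq_right (by linarith)] at e2
  have : (k - 2) * (r - s) = 0 := by linarith
  rcases mul_eq_zero.1 this with h | h
  · exact hk (by linarith)
  · linarith

theorem uniformMeasure_apply [Fintype ι] (N : EdgeParam X ι) (A : Set X) :
    uniformMeasure X A = (ENNReal.ofReal (∑ i, N.len i))⁻¹ * μH[1] A := by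
  rw [uniformMeasure, N.hausdorffMeasure_univ]; rfl

theorem uniformMeasure_real [Fintype ι] (N : EdgeParam X ι) (A : Set X) (hL : 0 < ∑ i, N.len i) :
    (uniformMeasure X).real A = (μH[1] : Measure X).real A / ∑ i, N.len i := by
  rw [Measure.real, N.uniformMeasure_apply, ENNReal.toReal_mul, ENNReal.toReal_inv,
    ENNReal.toReal_ofReal hL.le, div_eq_inv_mul]
  rfl

theorem uniformMeasure_univ [Fintype ι] [Nonempty ι] (N : EdgeParam X ι) :
    uniformMeasure X Set.univ = 1 := by
  rw [N.uniformMeasure_apply, N.hausdorffMeasure_univ]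
  exact ENNReal.inv_mul_cancel (by simpa using N.total_pos) ENNReal.ofReal_ne_top

theorem uniformMeasure_eq_zero_of_finite [Fintype ι] (N : EdgeParam X ι) {A : Set X}
    (hA : A.Finite) : uniformMeasure X A = 0 := by
  rw [N.uniformMeasure_apply, hausdorffMeasure_finite_eq_zero hA, mul_zero]

theorem uniformMeasure_ne_zero_of_isOpen [Fintype ι] (N : EdgeParam X ι) {U : Set X}
    (hU : IsOpen U) (hne : U.Nonempty) : uniformMeasure X U ≠ 0 := by
  obtain ⟨x, hx⟩ := hne
  obtain ⟨i, s, hs, rfl⟩ := N.cover x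
  obtain ⟨V, hV, hVU⟩ := continuousOn_iff'.1 (N.continuousOn_path i) U hU
  have hsV : s ∈ V := ((hVU ▸ ⟨hx, hs⟩ : s ∈ V ∩ Set.Icc 0 (N.len i))).1
  rw [← closure_Ioo (N.len_pos i).ne] at hs
  have hpos : 0 < volume (V ∩ Set.Ioo 0 (N.len i)) :=
    (hV.inter isOpen_Ioo).measure_pos _ (mem_closure_iff.1 hs V hV hsV)
  have hle : volume (V ∩ Set.Ioo 0 (N.len i)) ≤ μH[1] U := by
    rw [N.hausdorffMeasure_eq_sum hU.measurableSet]
    refine le_trans (measure_mono ?_) (Finset.single_le_sum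
      (f := fun i => volume (Set.Ioo 0 (N.len i) ∩ N.path i ⁻¹' U)) (fun _ _ => zero_le)
      (Finset.mem_univ i))
    rintro t ⟨ht, ht'⟩
    exact ⟨ht', ((hVU.symm ▸ ⟨ht, ht'.1.le, ht'.2.le⟩ :
      t ∈ N.path i ⁻¹' U ∩ Set.Icc 0 (N.len i))).1⟩
  rw [N.uniformMeasure_apply]
  exact mul_ne_zero (ENNReal.inv_ne_zero.2 ENNReal.ofReal_ne_top) (hpos.trans_le hle).ne'

end EdgeParam

theorem IsMMIsomorphism.localDistribution_eq {X Y : Type*} [MetricSpace X] [MeasurableSpace X]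
    [MetricSpace Y] [MeasurableSpace Y] [BorelSpace Y] {μ : Measure X} {ν : Measure Y} {f : X → Y}
    (hf : IsMMIsomorphism μ ν f) (x : X) (r : ℝ) :
    localDistribution μ x r = localDistribution ν (f x) r := by
  rw [localDistribution, localDistribution, Measure.real, Measure.real,
    ← hf.measurePreserving.measure_preimage Metric.isClosed_closedBall.nullMeasurableSet,
    hf.isometry.preimage_closedBall]

/-- Rotations act transitively on the circle and preserve ball measures. -/
theorem IsCircleGraph.localDistribution_eq {X : Type*} [MetricSpace X] [MeasurableSpace X]
    [BorelSpace X] (hX : IsCircleGraph X) (x y : X) (r : ℝ) :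
    localDistribution (uniformMeasure X) x r = localDistribution (uniformMeasure X) y r := by
  obtain ⟨T, hT, f, hf⟩ := hX
  have e : Isometry fun z : AddCircle T => z + (f y - f x) :=
    (IsometryEquiv.addRight (f y - f x)).isometry
  have he : Function.Surjective fun z : AddCircle T => z + (f y - f x) :=
    (IsometryEquiv.addRight (f y - f x)).surjective
  rw [hf.localDistribution_eq, hf.localDistribution_eq,
    (e.isMMIsomorphism_uniformMeasure he).localDistribution_eq (f x), add_sub_cancel]

/-- A connected set has at least the length of its diameter. -/
theorem edist_le_hausdorffMeasure_of_isPreconnected {X : Type*} [MetricSpace X] [MeasurableSpace X]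
    [BorelSpace X] {C : Set X} (hC : IsPreconnected C) {p q : X} (hp : p ∈ C) (hq : q ∈ C) :
    edist p q ≤ μH[1] C := by
  have h1 : LipschitzWith 1 (dist p) := LipschitzWith.dist_right p
  have h2 := h1.hausdorffMeasure_image_le (d := 1) zero_le_one C
  rw [hausdorffMeasure_real] at h2
  have h3 : Set.Icc (dist p p) (dist p q) ⊆ dist p '' C :=
    (hC.image _ h1.continuous.continuousOn).Icc_subset ⟨p, hp, rfl⟩ ⟨q, hq, rfl⟩
  have h4 := (measure_mono h3).trans h2
  rw [Real.volume_Icc, dist_self, sub_zero, ← edist_dist] at h4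
  simpa using h4

/-! ### From equal ball measures to an isometry -/

namespace EdgeParam

variable {G H : Type*} [MetricSpace G] [MeasurableSpace G] [BorelSpace G]
    [MetricSpace H] [MeasurableSpace H] [BorelSpace H] {ι κ : Type}

/-- A continuous map that does not increase length is `1`-Lipschitz. -/
theorem dist_map_le (N : EdgeParam G ι) {φ : G → H} (hφ : Continuous φ)
    (h : ∀ S, MeasurableSet S → μH[1] (φ '' S) ≤ μH[1] S) (x y : G) :
    dist (φ x) (φ y) ≤ dist x y := by
  have key : ∀ i, ∀ s ∈ Set.Icc 0 (N.len i), ∀ s' ∈ Set.Icc 0 (N.len i),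
      dist (φ (N.path i s)) (φ (N.path i s')) ≤ |s - s'| := by
    intro i s hs s' hs'
    have hsub : Set.uIcc s s' ⊆ Set.Icc 0 (N.len i) :=
      Set.ordConnected_Icc.uIcc_subset hs hs'
    have hcont := (N.continuousOn_path i).mono hsub
    have hm : MeasurableSet (N.path i '' Set.uIcc s s') :=
      (isCompact_uIcc.image_of_continuousOn hcont).isClosed.measurableSet
    have hc : IsPreconnected (φ '' (N.path i '' Set.uIcc s s')) :=
      (isPreconnected_uIcc.image _ hcont).image _ hφ.continuousOn
    have h1 := edist_le_hausdorffMeasure_of_isPreconnected hc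
      ⟨_, ⟨s, Set.left_mem_uIcc, rfl⟩, rfl⟩ ⟨_, ⟨s', Set.right_mem_uIcc, rfl⟩, rfl⟩
    have h2 := (h1.trans (h _ hm)).trans (N.hausdorffMeasure_image_le i hsub)
    rw [Real.volume_interval, edist_dist, ENNReal.ofReal_le_ofReal_iff (abs_nonneg _)] at h2
    rwa [abs_sub_comm]
  have := N.sub_le_dist (fun z => dist (φ z) (φ y)) (fun i s hs s' hs' => by
    have := key i s hs s' hs'
    linarith [dist_triangle (φ (N.path i s)) (φ (N.path i s')) (φ y)]) x y
  simpa using this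

variable [Fintype ι] [Fintype κ] {N : EdgeParam G ι} {M : EdgeParam H κ}

theorem Reduced.not_isCircleGraph [Nonempty ι] (hN : N.Reduced) (φ : G → H)
    (hdist : ∀ (x : G) (r : ℝ), 0 ≤ r →
      localDistribution (uniformMeasure G) x r = localDistribution (uniformMeasure H) (φ x) r) :
    ¬ IsCircleGraph H := by
  intro hH
  obtain ⟨i⟩ := ‹Nonempty ι›
  have : Nonempty ι := ⟨i⟩
  have hl := N.halves.len_pos (i, false)
  set l := N.halves.len (i, false)
  obtain ⟨k, hk, R, hR, h⟩ := hN.exists_measure_closedBall_halves (i, false)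
    -- Any two different parameters on one half edge would do: their kinks differ, while homogeneity
    -- of `H` would force them to agree.
    (s := l / 3) ⟨by linarith, by linarith⟩
  obtain ⟨k', -, R', hR', h'⟩ := hN.exists_measure_closedBall_halves (i, false)
    (s := l / 2) ⟨by linarith, by linarith⟩
  have := le_of_measure_closedBall_eq (by linarith) hk hR hR' h (fun r h0 hr => by
    rw [← h' r h0 hr]
    have e := ((hdist (N.halves.path (i, false) (l / 3)) r h0).trans (hH.localDistribution_eq _ _ r)).trans
      (hdist (N.halves.path (i, false) (l / 2)) r h0).symm
    rwa [localDistribution, localDistribution, N.uniformMeasure_real _ N.total_pos,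
      N.uniformMeasure_real _ N.total_pos, div_left_inj' N.total_pos.ne'] at e)
  linarith

theorem total_eq [Nonempty ι] [Nonempty κ] (hN : N.Reduced) (hM : M.Reduced) (φ : G → H)
    (hmp : MeasurePreserving φ (uniformMeasure G) (uniformMeasure H))
    (hdist : ∀ (x : G) (r : ℝ), 0 ≤ r →
      localDistribution (uniformMeasure G) x r = localDistribution (uniformMeasure H) (φ x) r) :
    ∑ i, N.len i = ∑ j, M.len j := by
  -- A generic point: neither it nor its image is a vertex, which excludes only a null set because
  -- `φ` preserves measure.
  obtain ⟨x, hx⟩ : ∃ x, x ∉ N.halves.vertices ∪ φ ⁻¹' M.halves.vertices := by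
    by_contra hc
    push Not at hc
    have h0 : uniformMeasure G (N.halves.vertices ∪ φ ⁻¹' M.halves.vertices) = 0 := by
      rw [measure_union_null_iff]
      refine ⟨N.uniformMeasure_eq_zero_of_finite N.halves.finite_vertices, ?_⟩
      rw [hmp.measure_preimage M.halves.finite_vertices.measurableSet.nullMeasurableSet]
      exact M.uniformMeasure_eq_zero_of_finite M.halves.finite_vertices
    rw [Set.eq_univ_of_forall hc, N.uniformMeasure_univ] at h0
    exact one_ne_zero h0
  rw [Set.mem_union, not_or] at hx
  obtain ⟨a, s, hs, hxs⟩ := (N.halves.mem_vertices_or x).resolve_left hx.1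
  obtain ⟨b, s', hs', hys⟩ := (M.halves.mem_vertices_or (φ x)).resolve_left hx.2
  obtain ⟨k, -, R, hR, h⟩ := hN.exists_measure_closedBall_halves a hs
  obtain ⟨k', -, R', hR', h'⟩ := hM.exists_measure_closedBall_halves b hs'
  have hr : 0 < min s s' := lt_min hs.1 hs'.1
  have e := hdist x (min s s') hr.le
  rw [localDistribution, localDistribution, N.uniformMeasure_real _ N.total_pos,
    M.uniformMeasure_real _ M.total_pos, ← hxs, hxs, ← hys, ← hxs,
    h _ hr.le ((min_le_left _ _).trans_lt hR), h' _ hr.le ((min_le_right _ _).trans_lt hR'),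
    max_eq_right (by linarith [min_le_left s s']), max_eq_right (by linarith [min_le_right s s']),
    mul_zero, mul_zero, add_zero, div_eq_div_iff N.total_pos.ne' M.total_pos.ne'] at e
  exact (mul_left_cancel₀ (by linarith : 2 * min s s' ≠ 0) e).symm

/-- The kink radius is the parameter on the half edge, so `φ` keeps parameters, and half edges are
parametrized isometrically. -/
theorem dist_map_eq [Nonempty ι] [Nonempty κ] (hN : N.Reduced) (hM : M.Reduced) (φ : G → H)
    (hmp : MeasurePreserving φ (uniformMeasure G) (uniformMeasure H))
    (hdist : ∀ (x : G) (r : ℝ), 0 ≤ r →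
      localDistribution (uniformMeasure G) x r = localDistribution (uniformMeasure H) (φ x) r)
    (a : ι × Bool) (b : κ × Bool) {x y : G} (hx : x ∈ N.halves.openEdge a)
    (hy : y ∈ N.halves.openEdge a) (hx' : φ x ∈ M.halves.openEdge b)
    (hy' : φ y ∈ M.halves.openEdge b) : dist (φ x) (φ y) = dist x y := by
  have hL := total_eq hN hM φ hmp hdist
  have key : ∀ s ∈ Set.Ioo 0 (N.halves.len a), ∀ t ∈ Set.Ioo 0 (M.halves.len b),
      M.halves.path b t = φ (N.halves.path a s) → t = s := by
    intro s hs t ht hst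
    obtain ⟨k, hk, R, hR, h⟩ := hN.exists_measure_closedBall_halves a hs
    obtain ⟨k', hk', R', hR', h'⟩ := hM.exists_measure_closedBall_halves b ht
    have e : ∀ r, 0 ≤ r → (μH[1] : Measure G).real (Metric.closedBall (N.halves.path a s) r) =
        (μH[1] : Measure H).real (Metric.closedBall (M.halves.path b t) r) := fun r hr => by
      have e := hdist (N.halves.path a s) r hr
      rwa [localDistribution, localDistribution, N.uniformMeasure_real _ N.total_pos,
        M.uniformMeasure_real _ M.total_pos, hL, div_left_inj' M.total_pos.ne', ← hst] at e
    exact le_antisymm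
      (le_of_measure_closedBall_eq hs.1 hk hR hR' h fun r h0 hr => (e r h0).trans (h' r h0 hr))
      (le_of_measure_closedBall_eq ht.1 hk' hR' hR h' fun r h0 hr => (e r h0).symm.trans (h r h0 hr))
  obtain ⟨s, hs, rfl⟩ := hx
  obtain ⟨s', hs', rfl⟩ := hy
  obtain ⟨t, ht, h1⟩ := hx'
  obtain ⟨t', ht', h2⟩ := hy'
  rw [← h1, ← h2, M.dist_path_halves b _ ⟨ht.1.le, ht.2.le⟩ _ ⟨ht'.1.le, ht'.2.le⟩,
    N.dist_path_halves a _ ⟨hs.1.le, hs.2.le⟩ _ ⟨hs'.1.le, hs'.2.le⟩,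
    key s hs t ht h1, key s' hs' t' ht' h2]

theorem hausdorffMeasure_image_le_of_reduced [Nonempty ι] [Nonempty κ] (hN : N.Reduced)
    (hM : M.Reduced) (φ : G → H)
    (hmp : MeasurePreserving φ (uniformMeasure G) (uniformMeasure H))
    (hdist : ∀ (x : G) (r : ℝ), 0 ≤ r →
      localDistribution (uniformMeasure G) x r = localDistribution (uniformMeasure H) (φ x) r)
    {S : Set G} (hS : MeasurableSet S) : μH[1] (φ '' S) ≤ μH[1] S := by
  -- The pieces on which `dist_map_eq` applies. They need not be connected, so only measures, not
  -- distances, are compared at this stage.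
  let A : (ι × Bool) × (κ × Bool) → Set G := fun c =>
    S ∩ (N.halves.openEdge c.1 ∩ φ ⁻¹' M.halves.openEdge c.2)
  have hA : ∀ c, MeasurableSet (A c) := fun c =>
    hS.inter ((N.halves.isOpen_openEdge c.1).measurableSet.inter
      (hmp.measurable (M.halves.isOpen_openEdge c.2).measurableSet))
  have hdisj : Pairwise (Function.onFun Disjoint A) := by
    rintro ⟨a, b⟩ ⟨a', b'⟩ hne
    by_cases ha : a = a'
    · have hb : b ≠ b' := fun hb => hne (by rw [ha, hb])
      exact ((M.halves.disjoint_openEdge hb).preimage φ).mono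
        (Set.inter_subset_right.trans Set.inter_subset_right)
        (Set.inter_subset_right.trans Set.inter_subset_right)
    · exact (N.halves.disjoint_openEdge ha).mono
        (Set.inter_subset_right.trans Set.inter_subset_left)
        (Set.inter_subset_right.trans Set.inter_subset_left)
  have hcov : φ '' S ⊆ (φ '' N.halves.vertices ∪ M.halves.vertices) ∪ ⋃ c, φ '' A c := by
    rintro _ ⟨x, hx, rfl⟩
    rcases N.halves.mem_vertices_or x with h | ⟨a, ha⟩
    · exact Or.inl (Or.inl ⟨x, h, rfl⟩)
    rcases M.halves.mem_vertices_or (φ x) with h | ⟨b, hb⟩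
    · exact Or.inl (Or.inr h)
    · exact Or.inr (Set.mem_iUnion.2 ⟨(a, b), x, ⟨hx, ha, hb⟩, rfl⟩)
  calc μH[1] (φ '' S) ≤ μH[1] (φ '' N.halves.vertices ∪ M.halves.vertices) +
        μH[1] (⋃ c, φ '' A c) := (measure_mono hcov).trans (measure_union_le _ _)
    _ = μH[1] (⋃ c, φ '' A c) := by
        rw [hausdorffMeasure_finite_eq_zero
          ((N.halves.finite_vertices.image φ).union M.halves.finite_vertices), zero_add]
    _ ≤ ∑ c, μH[1] (φ '' A c) := measure_iUnion_fintype_le _ _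
    _ ≤ ∑ c, μH[1] (A c) := by
        refine Finset.sum_le_sum fun c _ => ?_
        have : LipschitzOnWith 1 φ (A c) := LipschitzOnWith.of_dist_le_mul fun x hx y hy => by
          rw [NNReal.coe_one, one_mul]
          exact (dist_map_eq hN hM φ hmp hdist c.1 c.2 hx.2.1 hy.2.1 hx.2.2 hy.2.2).le
        simpa using this.hausdorffMeasure_image_le zero_le_one
    _ = μH[1] (⋃ c, A c) := by rw [measure_iUnion hdisj hA, tsum_fintype]
    _ ≤ μH[1] S := measure_mono (Set.iUnion_subset fun c => Set.inter_subset_left)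

theorem isometry_of_dist_map_le [Nonempty ι] (N : EdgeParam G ι) {φ : G → H} (hφ : Continuous φ)
    (hmp : MeasurePreserving φ (uniformMeasure G) (uniformMeasure H))
    (hdist : ∀ (x : G) (r : ℝ), 0 ≤ r →
      localDistribution (uniformMeasure G) x r = localDistribution (uniformMeasure H) (φ x) r)
    (h : ∀ x y, dist (φ x) (φ y) ≤ dist x y) : Isometry φ := by
  have : IsFiniteMeasure (uniformMeasure G) := ⟨by rw [N.uniformMeasure_univ]; exact ENNReal.one_lt_top⟩
  refine Isometry.of_dist_eq fun x y => (h x y).antisymm ?_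
  by_contra hc
  push Not at hc
  obtain ⟨r, hr1, hr2⟩ := exists_between hc
  have e := hdist x r (dist_nonneg.trans hr1.le)
  rw [localDistribution, localDistribution, Measure.real, Measure.real,
    ← hmp.measure_preimage Metric.isClosed_closedBall.nullMeasurableSet,
    ENNReal.toReal_eq_toReal_iff' (measure_ne_top _ _) (measure_ne_top _ _)] at e
  have hsub : Metric.closedBall x r ⊆ φ ⁻¹' Metric.closedBall (φ x) r := fun z hz =>
    (h z x).trans hz
  have h0 : uniformMeasure G (φ ⁻¹' Metric.closedBall (φ x) r \ Metric.closedBall x r) = 0 := by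
    rw [measure_sdiff hsub Metric.isClosed_closedBall.nullMeasurableSet (measure_ne_top _ _), e,
      tsub_self]
  -- If the distance from `x` to `y` shrank across `r`, then all points near `y` would lie in the
  -- null difference of the two balls.
  refine N.uniformMeasure_ne_zero_of_isOpen
    (U := {z | dist (φ x) (φ z) < r} ∩ {z | r < dist x z})
    ((isOpen_lt (by fun_prop) (by fun_prop)).inter (isOpen_lt (by fun_prop) (by fun_prop)))
    ⟨y, hr1, hr2⟩ (measure_mono_null ?_ h0)
  rintro z ⟨hz1, hz2⟩
  refine ⟨?_, ?_⟩
  · rw [Set.mem_preimage, Metric.mem_closedBall, dist_comm]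
    exact hz1.le
  · rw [Metric.mem_closedBall, dist_comm, not_le]
    exact hz2

theorem surjective_of_measurePreserving [CompactSpace G] (M : EdgeParam H κ) {φ : G → H}
    (hφ : Continuous φ) (hmp : MeasurePreserving φ (uniformMeasure G) (uniformMeasure H)) :
    Function.Surjective φ := by
  rw [← Set.range_eq_univ]
  by_contra hc
  have ho : IsOpen (Set.range φ)ᶜ := (isCompact_range hφ).isClosed.isOpen_compl
  refine M.uniformMeasure_ne_zero_of_isOpen ho (Set.nonempty_compl.2 hc) ?_
  rw [← hmp.measure_preimage ho.measurableSet.nullMeasurableSet]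
  simp

end EdgeParam

/-! ### Arclength presentation of a geometric realization -/

namespace WeightedComplex

variable {V : Type}

/-- An orientation of the edges. -/
noncomputable def src (K : WeightedComplex V) (e : K.graph.edgeSet) : V := e.1.out.1

noncomputable def tgt (K : WeightedComplex V) (e : K.graph.edgeSet) : V := e.1.out.2

theorem mk_src_tgt (K : WeightedComplex V) (e : K.graph.edgeSet) :
    s(K.src e, K.tgt e) = e.1 := e.1.out_eq

theorem adj_src_tgt (K : WeightedComplex V) (e : K.graph.edgeSet) :
    K.graph.Adj (K.src e) (K.tgt e) := by
  rw [← SimpleGraph.mem_edgeSet, mk_src_tgt]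
  exact e.2

theorem len_pos (K : WeightedComplex V) (e : K.graph.edgeSet) : 0 < K.length e.1 :=
  K.length_pos e.1 e.2

theorem div_length_mem (K : WeightedComplex V) (e : K.graph.edgeSet) {s : ℝ}
    (hs : s ∈ Set.Icc 0 (K.length e.1)) : s / K.length e.1 ∈ Set.Icc (0 : ℝ) 1 :=
  ⟨div_nonneg hs.1 (K.len_pos e).le, (div_le_one (K.len_pos e)).2 hs.2⟩

variable [Fintype V]

open Classical in
/-- The point of the edge from `u` to `v` that divides it in the ratio `t : 1 - t`. -/
noncomputable def edgePoint (K : WeightedComplex V) (u v : V) (h : K.graph.Adj u v) (t : ℝ)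
    (ht : t ∈ Set.Icc (0 : ℝ) 1) : K.Realization :=
  ⟨fun x => if x = u then 1 - t else if x = v then t else 0, by
    have huv := h.ne
    refine ⟨fun x => ?_, ?_, Or.inr ⟨u, v, h, fun x hx => ?_⟩⟩
    · have := ht.1
      have := ht.2
      dsimp only
      split_ifs <;> linarith
    · rw [← Finset.add_sum_erase _ _ (Finset.mem_univ u), ← Finset.add_sum_erase _ _
        (Finset.mem_erase.2 ⟨huv.symm, Finset.mem_univ v⟩), Finset.sum_eq_zero]
      · simp [huv.symm]
      · intro x hx
        simp only [Finset.mem_erase, Finset.mem_univ, and_true] at hx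
        simp [hx.1, hx.2]
    · by_contra hc
      push Not at hc
      exact hx (by simp [hc.1, hc.2])⟩

theorem edgePoint_left (K : WeightedComplex V) {u v : V} (h : K.graph.Adj u v) {t : ℝ}
    (ht : t ∈ Set.Icc (0 : ℝ) 1) : (K.edgePoint u v h t ht).1 u = 1 - t := by
  simp [edgePoint]

theorem edgePoint_right (K : WeightedComplex V) {u v : V} (h : K.graph.Adj u v) {t : ℝ}
    (ht : t ∈ Set.Icc (0 : ℝ) 1) : (K.edgePoint u v h t ht).1 v = t := by
  simp [edgePoint, h.ne.symm]

theorem onEdge_edgePoint (K : WeightedComplex V) {u v : V} (h : K.graph.Adj u v) {t : ℝ}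
    (ht : t ∈ Set.Icc (0 : ℝ) 1) : OnEdge (K.edgePoint u v h t ht) u v := by
  intro x hx
  by_contra hc
  push Not at hc
  exact hx (by simp [edgePoint, hc.1, hc.2])

theorem OnEdge.add_eq_one {K : WeightedComplex V} {p : K.Realization} {u v : V} (h : u ≠ v)
    (hp : OnEdge p u v) : p.1 u + p.1 v = 1 := by
  classical
  have hsum := p.2.2.1
  rwa [← Finset.add_sum_erase _ _ (Finset.mem_univ u), ← Finset.add_sum_erase _ _
    (Finset.mem_erase.2 ⟨h.symm, Finset.mem_univ v⟩), Finset.sum_eq_zero, add_zero] at hsum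
  intro x hx
  simp only [Finset.mem_erase, Finset.mem_univ, and_true] at hx
  by_contra hc
  rcases hp x hc with h | h
  · exact hx.2 h
  · exact hx.1 h

theorem OnEdge.mem_Icc {K : WeightedComplex V} {p : K.Realization} {u v : V} (h : u ≠ v)
    (hp : OnEdge p u v) : p.1 v ∈ Set.Icc (0 : ℝ) 1 :=
  ⟨p.2.1 v, by linarith [hp.add_eq_one h, p.2.1 u]⟩

theorem OnEdge.eq_edgePoint {K : WeightedComplex V} {p : K.Realization} {u v : V}
    (h : K.graph.Adj u v) (hp : OnEdge p u v) :
    K.edgePoint u v h (p.1 v) (hp.mem_Icc h.ne) = p := by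
  apply Subtype.ext
  funext x
  by_cases hu : x = u
  · subst hu
    have := hp.add_eq_one h.ne
    simp [edgePoint]
    linarith
  by_cases hv : x = v
  · subst hv
    simp [edgePoint, hu]
  · have : p.1 x = 0 := by
      by_contra hc
      rcases hp x hc with h | h
      · exact hu h
      · exact hv h
    simp [edgePoint, hu, hv, this]

theorem OnEdge.symm {K : WeightedComplex V} {p : K.Realization} {u v : V} (hp : OnEdge p u v) :
    OnEdge p v u := fun x hx => (hp x hx).symm

theorem PathLength.exists_onEdge {K : WeightedComplex V} {p q : K.Realization} {L : ℝ}
    (h : K.PathLength p q L) (hpq : p ≠ q) : ∃ u v, K.graph.Adj u v ∧ OnEdge p u v := by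
  cases h with
  | refl => exact absurd rfl hpq
  | step u v _ _ _ L hadj hp => exact ⟨u, v, hadj, hp⟩

theorem exists_onEdge_src_tgt {K : WeightedComplex V} {p : K.Realization} {u v : V}
    (h : K.graph.Adj u v) (hp : OnEdge p u v) :
    ∃ e : K.graph.edgeSet, e.1 = s(u, v) ∧ OnEdge p (K.src e) (K.tgt e) := by
  refine ⟨⟨s(u, v), h⟩, rfl, ?_⟩
  have := K.mk_src_tgt ⟨s(u, v), h⟩
  rw [Sym2.eq_iff] at this
  rcases this with ⟨h1, h2⟩ | ⟨h1, h2⟩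
  · rw [h1, h2]; exact hp
  · rw [h1, h2]; exact hp.symm

/-- The point at distance `s` from the source of an edge, for `s` at most the length. -/
noncomputable def edgeMap (K : WeightedComplex V) (e : K.graph.edgeSet) (s : ℝ) : K.Realization :=
  K.edgePoint (K.src e) (K.tgt e) (K.adj_src_tgt e) (Set.projIcc 0 1 zero_le_one (s / K.length e.1))
    (Set.projIcc 0 1 zero_le_one (s / K.length e.1)).2

theorem edgeMap_src (K : WeightedComplex V) (e : K.graph.edgeSet) {s : ℝ}
    (hs : s ∈ Set.Icc 0 (K.length e.1)) :
    (K.edgeMap e s).1 (K.src e) = 1 - s / K.length e.1 := by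
  rw [edgeMap, edgePoint_left, Set.projIcc_of_mem _ (K.div_length_mem e hs)]

theorem edgeMap_tgt (K : WeightedComplex V) (e : K.graph.edgeSet) {s : ℝ}
    (hs : s ∈ Set.Icc 0 (K.length e.1)) :
    (K.edgeMap e s).1 (K.tgt e) = s / K.length e.1 := by
  rw [edgeMap, edgePoint_right, Set.projIcc_of_mem _ (K.div_length_mem e hs)]

theorem onEdge_edgeMap (K : WeightedComplex V) (e : K.graph.edgeSet) (s : ℝ) :
    OnEdge (K.edgeMap e s) (K.src e) (K.tgt e) := K.onEdge_edgePoint _ _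

theorem OnEdge.eq_edgeMap {K : WeightedComplex V} {p : K.Realization} {e : K.graph.edgeSet}
    (hp : OnEdge p (K.src e) (K.tgt e)) :
    ∃ s ∈ Set.Icc 0 (K.length e.1), K.edgeMap e s = p := by
  have hl := K.len_pos e
  have hm := hp.mem_Icc (K.adj_src_tgt e).ne
  refine ⟨K.length e.1 * p.1 (K.tgt e), ⟨mul_nonneg hl.le hm.1, mul_le_of_le_one_right hl.le hm.2⟩, ?_⟩
  conv_rhs => rw [← hp.eq_edgePoint (K.adj_src_tgt e)]
  rw [edgeMap]
  congr 1
  rw [mul_div_cancel_left₀ _ hl.ne', Set.projIcc_of_mem _ hm]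

theorem edgeMap_inj (K : WeightedComplex V) (e e' : K.graph.edgeSet) {s s' : ℝ}
    (hs : s ∈ Set.Ioo 0 (K.length e.1)) (hs' : s' ∈ Set.Icc 0 (K.length e'.1))
    (h : K.edgeMap e s = K.edgeMap e' s') : e = e' ∧ s = s' := by
  have hl := K.len_pos e
  have hs2 : s ∈ Set.Icc 0 (K.length e.1) := ⟨hs.1.le, hs.2.le⟩
  -- An interior point has both end coordinates nonzero, so its support determines the edge.
  have h1 : (K.edgeMap e' s').1 (K.src e) ≠ 0 := by
    rw [← h, K.edgeMap_src e hs2]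
    have := (div_lt_one hl).2 hs.2
    exact (by linarith : 0 < 1 - s / K.length e.1).ne'
  have h2 : (K.edgeMap e' s').1 (K.tgt e) ≠ 0 := by
    rw [← h, K.edgeMap_tgt e hs2]
    exact (div_pos hs.1 hl).ne'
  have he : e = e' := by
    apply Subtype.ext
    rw [← K.mk_src_tgt e, ← K.mk_src_tgt e', Sym2.eq_iff]
    have hne := (K.adj_src_tgt e).ne
    rcases K.onEdge_edgeMap e' s' _ h1 with h3 | h3 <;>
      rcases K.onEdge_edgeMap e' s' _ h2 with h4 | h4
    · exact absurd (h3.trans h4.symm) hne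
    · exact Or.inl ⟨h3, h4⟩
    · exact Or.inr ⟨h3, h4⟩
    · exact absurd (h3.trans h4.symm) hne
  subst he
  have h3 := K.edgeMap_tgt e hs2
  rw [h, K.edgeMap_tgt e hs', div_left_inj' hl.ne'] at h3
  exact ⟨rfl, h3.symm⟩

/-- The length of a segment in terms of the parametrization of its edge. -/
theorem length_mul_abs_sub (K : WeightedComplex V) (e : K.graph.edgeSet) {u v : V}
    (h : s(u, v) = e.1) {s s' : ℝ} (hs : s ∈ Set.Icc 0 (K.length e.1))
    (hs' : s' ∈ Set.Icc 0 (K.length e.1)) :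
    K.length s(u, v) * |(K.edgeMap e s).1 u - (K.edgeMap e s').1 u| = |s - s'| := by
  have hl := K.len_pos e
  have key : |(K.edgeMap e s).1 u - (K.edgeMap e s').1 u| = |s - s'| / K.length e.1 := by
    rw [← K.mk_src_tgt e, Sym2.eq_iff] at h
    rcases h with ⟨h, -⟩ | ⟨h, -⟩
    · rw [h, edgeMap_src _ _ hs, edgeMap_src _ _ hs', abs_sub_comm, ← abs_of_pos hl, ← abs_div,
        abs_of_pos hl]
      congr 1
      ring
    · rw [h, edgeMap_tgt _ _ hs, edgeMap_tgt _ _ hs', ← sub_div, abs_div, abs_of_pos hl]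
  rw [key, h, mul_div_cancel₀ _ hl.ne']

end WeightedComplex

-- One polygonal segment bounds the distance along an edge from above; conversely, summing a
-- Lipschitz estimate over the segments of any path bounds the infimum of lengths from below.
open WeightedComplex in
theorem IsMetricGraph.exists_edgeParam {X : Type*} [MetricSpace X] (hX : IsMetricGraph X) :
    ∃ (ι : Type) (_ : Fintype ι), Nonempty (EdgeParam X ι) := by
  classical
  obtain ⟨-, -, V, _, K, f, hf⟩ := hX
  have hcov : ∀ p : K.Realization, ∃ u v, K.graph.Adj u v ∧ OnEdge p u v := by
    intro p
    obtain ⟨q, hq⟩ : ∃ q, p ≠ q := by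
      obtain ⟨e, he⟩ := K.exists_edge
      let e' : K.graph.edgeSet := ⟨e, he⟩
      have hne : K.edgeMap e' 0 ≠ K.edgeMap e' (K.length e'.1) := by
        intro h
        have hl := K.len_pos e'
        have h1 := K.edgeMap_tgt e' (s := 0) ⟨le_rfl, hl.le⟩
        rw [h, K.edgeMap_tgt e' ⟨hl.le, le_rfl⟩, div_self hl.ne', zero_div] at h1
        exact one_ne_zero h1
      by_contra hc
      push Not at hc
      exact hne ((hc _).symm.trans (hc _))
    -- The empty set has no greatest lower bound in `ℝ`, so some path joins `p` to a different point
    -- `q`. Its first step puts `p` on an edge, so there are no isolated vertices.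
    have hne : {L : ℝ | K.PathLength p q L}.Nonempty := by
      have := (hf (f.symm p) (f.symm q)).nonempty
      simpa using this
    obtain ⟨L, hL⟩ := hne
    exact PathLength.exists_onEdge hL hq
  refine ⟨K.graph.edgeSet, inferInstance, ⟨{
    len := fun e => K.length e.1
    path := fun e s => f.symm (K.edgeMap e s)
    len_pos := K.len_pos
    cover := fun x => ?_
    inj := fun e e' s hs s' hs' h => K.edgeMap_inj e e' hs hs' (f.symm.injective h)
    dist_le := fun e s hs s' hs' => ?_
    sub_le_dist := fun F hF x y => ?_ }⟩⟩
  · obtain ⟨u, v, h, hp⟩ := hcov (f x)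
    obtain ⟨e, -, he⟩ := exists_onEdge_src_tgt h hp
    obtain ⟨s, hs, h⟩ := he.eq_edgeMap
    exact ⟨e, s, hs, by rw [h, f.symm_apply_apply]⟩
  · refine (hf _ _).1 ?_
    rw [f.apply_symm_apply, f.apply_symm_apply, Set.mem_ofPred_eq,
      ← K.length_mul_abs_sub e (K.mk_src_tgt e) hs hs', ← add_zero (_ * _)]
    exact PathLength.step _ _ _ _ _ _ (K.adj_src_tgt e) (K.onEdge_edgeMap e s)
      (K.onEdge_edgeMap e s') (PathLength.refl _)
  · have key : ∀ (p q : K.Realization) (L : ℝ), K.PathLength p q L →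
        F (f.symm p) - F (f.symm q) ≤ L := by
      intro p q L h
      induction h with
      | refl => simp
      | step u v p q r L hadj hp hq hqr ih =>
        obtain ⟨e, he, hpe⟩ := exists_onEdge_src_tgt hadj hp
        obtain ⟨e', he', hqe⟩ := exists_onEdge_src_tgt hadj hq
        obtain rfl : e = e' := Subtype.ext (he.trans he'.symm)
        obtain ⟨s, hs, rfl⟩ := hpe.eq_edgeMap
        obtain ⟨s', hs', rfl⟩ := hqe.eq_edgeMap
        rw [K.length_mul_abs_sub e he.symm hs hs']
        linarith [hF e s hs s' hs']
    refine (hf x y).2 fun L hL => ?_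
    have := key _ _ _ hL
    rwa [f.symm_apply_apply, f.symm_apply_apply] at this

theorem mainTheorem2 {G H : Type*}
    [MetricSpace G] [MeasurableSpace G] [BorelSpace G]
    [MetricSpace H] [MeasurableSpace H] [BorelSpace H]
    (hG : IsMetricGraph G) (hH : IsMetricGraph H) (hcirc : ¬ IsCircleGraph G)
    (φ : G → H) (hcont : Continuous φ)
    (hmp : MeasurePreserving φ (uniformMeasure G) (uniformMeasure H))
    (hdist : ∀ (x : G) (r : ℝ), 0 ≤ r →
      localDistribution (uniformMeasure G) x r = localDistribution (uniformMeasure H) (φ x) r) :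
    IsMMIsomorphism (uniformMeasure G) (uniformMeasure H) φ := by
  have := hG.1
  obtain ⟨x⟩ : Nonempty G := hG.2.1.toNonempty
  obtain ⟨ι₀, _, ⟨N₀⟩⟩ := hG.exists_edgeParam
  obtain ⟨κ₀, _, ⟨M₀⟩⟩ := hH.exists_edgeParam
  obtain ⟨ι, _, N, hN⟩ := (N₀.isCircleGraph_or_exists_reduced _ ι₀ rfl).resolve_left hcirc
  have hι : Nonempty ι := ⟨(N.cover x).choose⟩
  obtain ⟨κ, _, M, hM⟩ := (EdgeParam.isCircleGraph_or_exists_reduced _ κ₀ rfl M₀).resolve_left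
    (hN.not_isCircleGraph φ hdist)
  have hκ : Nonempty κ := ⟨(M.cover (φ x)).choose⟩
  exact ⟨hmp, N.isometry_of_dist_map_le hcont hmp hdist (N.dist_map_le hcont fun S hS =>
    EdgeParam.hausdorffMeasure_image_le_of_reduced hN hM φ hmp hdist hS),
    M.surjective_of_measurePreserving hcont hmp⟩
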